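/- Conventions. Let $X$ be a locally finite tree, with $\mathrm{Aut}(X)$ given the topology of pointwise convergence; let $G$ be a closed subgroup of $\mathrm{Aut}(X)$, and let $\Gamma$ be a lattice in $G$, i.e. a discrete subgroup for which there is a nonzero finite $G$-invariant regular Borel measure $\mu_{\Gamma\backslash G}$ on $\Gamma\backslash G$. Assume that $\Gamma$ acts on $X$ without inversion (no element of $\Gamma$ maps an oriented edge to its reverse). Let $\rho_{\Gamma\backslash G}$ be the unitary representation of $G$ on $L^2(\Gamma\backslash G,\mu_{\Gamma\backslash G})$ by right translation. One says that $L^2(\Gamma\backslash G)$ has a spectral gap if the restriction of $\rho_{\Gamma\backslash G}$ to $L^2_0(\Gamma\backslash G)=\{\xi\in L^2(\Gamma\backslash G):\int\xi\,d\mu_{\Gamma\backslash G}=0\}$ has no almost invariant vectors, that is, if it is not the case that for every compact $Q\subset G$ and every $\varepsilon>0$ there is a unit vector $\xi\in L^2_0(\Gamma\backslash G)$ with $\sup_{g\in Q}\|\rho_{\Gamma\backslash G}(g)\xi-\xi\|<\varepsilon$. Let $D=\Gamma\backslash X$ be the quotient graph with vertex set $VD$ and set of oriented edges $ED$, where $e\in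 ED$ has origin $\partial_0e$, terminus $\partial_1e$ and reverse $\bar e$. For a vertex or an oriented edge $y$ of $D$, represented by $\tilde y$ in $X$, put $\mu(y)=1/|\Gamma_{\tilde y}|$, where $\Gamma_{\tilde y}$ is the stabilizer; for $e\in ED$ represented by $\tilde e$ put $i(e)=[\Gamma_{\partial_0\tilde e}:\Gamma_{\tilde e}]$. One says that $D=(D,i,\mu)$ is a diagram of finite volume if $i$ and $\mu$ take positive (finite) values, $i(e)\mu(\partial_0 e)=\mu(e)=\mu(\bar e)$ for all $e\in ED$, and $\sum_{x\in VD}\mu(x)<\infty$. It is an expander diagram if there is $\varepsilon>0$ with $\mu(E(S,S^c))/\mu(S)\ge\varepsilon$ for every nonempty $S\subset VD$ with $\mu(S)\le\mu(VD)/2$, where $E(S,S^c)=\{e\in ED:\partial_0e\in S,\ \partial_1e\notin S\}$ and the measure of a set of vertices or of edges is the sum of the measures of its elements. Proposition. In addition, let $X$ be either the $k$-regular tree $X_k$ with $k\ge3$, or the bi-partite bi-regular tree $X_{k_0,k_1}$ with $k_0,k_1\ge3$, in which every vertex of the first (second) class of the bipartition has degree $k_0$ ($k_1$). Assume that * $G$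 is transitive on the vertices of $X$ if $X=X_k$, and any two vertices in the same class of the bipartition lie in the same $G$-orbit if $X=X_{k_0,k_1}$; * the action of $G$ on $X$ is locally $\infty$-transitive: for every vertex $x$ and every $n\ge1$, the stabilizer $G_x$ acts transitively on the sphere $\{y: d(x,y)=n\}$. Then $D=\Gamma\backslash X$ is a diagram of finite volume, and $L^2(\Gamma\backslash G)$ has a spectral gap if and only if $D$ is an expander diagram. -/

import Mathlib

open MeasureTheory Topology
open scoped NNReal ENNReal

/-! ### Unitary representations and almost invariant vectors -/

set_option linter.unusedSectionVars false

section Representation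

variable {G : Type*} [Group G] [TopologicalSpace G]

/-- Almost invariant vectors of a unitary representation. (A homomorphism from a group into the
monoid of linear isometries takes values in the unitary operators.) -/
def HasAlmostInvariantVectors {H : Type*} [NormedAddCommGroup H] [InnerProductSpace ℂ H]
    (π : G →* (H →ₗᵢ[ℂ] H)) : Prop :=
  ∀ Q : Set G, IsCompact Q → ∀ ε : ℝ, 0 < ε →
    ∃ ξ : H, ‖ξ‖ = 1 ∧ ∃ δ < ε, ∀ x ∈ Q, ‖π x ξ - ξ‖ ≤ δ

/-! ### The space `Γ \ G`, lattices and the right regular representation -/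

/-- The space `Γ \ G` of right cosets `Γ x`. -/
def RightCosets (Γ : Subgroup G) : Type _ := Quotient (QuotientGroup.rightRel Γ)

namespace RightCosets

variable (Γ : Subgroup G)

/-- The coset `Γ x`. -/
def mk (x : G) : RightCosets Γ := Quotient.mk (QuotientGroup.rightRel Γ) x

/-- The quotient topology. -/
instance : TopologicalSpace (RightCosets Γ) :=
  inferInstanceAs (TopologicalSpace (Quotient (QuotientGroup.rightRel Γ)))

/-- The Borel sets of the quotient topology. -/
instance : MeasurableSpace (RightCosets Γ) := borel _

instance : BorelSpace (RightCosets Γ) := ⟨rfl⟩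

/-- Right translation `Γ x ↦ Γ x g`. -/
def translate (g : G) : RightCosets Γ → RightCosets Γ :=
  Quotient.map (fun x : G => x * g) (by
    intro a b h
    change QuotientGroup.rightRel Γ a b at h
    change QuotientGroup.rightRel Γ (a * g) (b * g)
    rw [QuotientGroup.rightRel_apply] at h ⊢
    simpa [mul_assoc] using h)

@[simp] lemma translate_mk (g x : G) : translate Γ g (mk Γ x) = mk Γ (x * g) := rfl

lemma translate_one : translate Γ (1 : G) = id := by
  funext q
  induction q using Quotient.inductionOn with
  | h x => exact congrArg (mk Γ) (mul_one x)

lemma translate_mul (g h : G) : translate Γ (g * h) = translate Γ h ∘ translate Γ g := by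
  funext q
  induction q using Quotient.inductionOn with
  | h x => exact congrArg (mk Γ) (mul_assoc x g h).symm

lemma continuous_translate [IsTopologicalGroup G] (g : G) : Continuous (translate Γ g) :=
  Continuous.quotient_map' (continuous_mul_const g) _

end RightCosets

/-- `μ` is a (nonzero) finite `G`-invariant regular Borel measure on `Γ \ G`. -/
structure IsInvariantVolume (Γ : Subgroup G) (μ : Measure (RightCosets Γ)) : Prop where
  finite : IsFiniteMeasure μ
  regular : μ.Regular
  ne_zero : μ ≠ 0
  invariant : ∀ g : G, μ.map (RightCosets.translate Γ g) = μ

/-- `Γ` is a lattice in `G`. -/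
def IsLatticeSubgroup (Γ : Subgroup G) : Prop :=
  DiscreteTopology Γ ∧ ∃ μ : Measure (RightCosets Γ), IsInvariantVolume Γ μ

section Regular

variable [IsTopologicalGroup G] {Γ : Subgroup G} {μ : Measure (RightCosets Γ)}

lemma IsInvariantVolume.measurePreserving (hμ : IsInvariantVolume Γ μ) (g : G) :
    MeasurePreserving (RightCosets.translate Γ g) μ μ :=
  ⟨(RightCosets.continuous_translate Γ g).measurable, hμ.invariant g⟩

/-- The right regular representation of `G` on `L²(Γ \ G, μ)`: `(ρ(g) ξ)(y) = ξ(y g)`. -/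
noncomputable def rightRegular (hμ : IsInvariantVolume Γ μ) :
    G →* (Lp ℂ 2 μ →ₗᵢ[ℂ] Lp ℂ 2 μ) where
  toFun g := Lp.compMeasurePreservingₗᵢ ℂ (RightCosets.translate Γ g) (hμ.measurePreserving g)
  map_one' := by
    ext1 ξ
    apply Lp.ext
    refine (Lp.coeFn_compMeasurePreserving ξ (hμ.measurePreserving 1)).trans ?_
    rw [RightCosets.translate_one]
    rfl
  map_mul' g h := by
    ext1 ξ
    apply Lp.ext
    refine (Lp.coeFn_compMeasurePreserving ξ (hμ.measurePreserving (g * h))).trans ?_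
    rw [RightCosets.translate_mul]
    refine Filter.EventuallyEq.symm ((Lp.coeFn_compMeasurePreserving _
      (hμ.measurePreserving g)).trans ?_)
    exact (hμ.measurePreserving g).quasiMeasurePreserving.ae_eq_comp
      (Lp.coeFn_compMeasurePreserving ξ (hμ.measurePreserving h))

lemma rightRegular_coeFn (hμ : IsInvariantVolume Γ μ) (g : G) (ξ : Lp ℂ 2 μ) :
    rightRegular hμ g ξ =ᵐ[μ] fun y => ξ (RightCosets.translate Γ g y) :=
  Lp.coeFn_compMeasurePreserving ξ (hμ.measurePreserving g)

/-- `L²₀(Γ \ G, μ)`: the square integrable functions with integral zero. -/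
noncomputable def L2Zero (hμ : IsInvariantVolume Γ μ) : Submodule ℂ (Lp ℂ 2 μ) where
  carrier := {ξ | ∫ y, ξ y ∂μ = 0}
  zero_mem' := by
    rw [Set.mem_ofPred_eq, integral_congr_ae (Lp.coeFn_zero ℂ 2 μ)]
    simp
  add_mem' := by
    intro ξ η hξ hη
    have := hμ.finite
    have h1 : Integrable ξ μ := (Lp.memLp ξ).integrable (by norm_num)
    have h2 : Integrable η μ := (Lp.memLp η).integrable (by norm_num)
    rw [Set.mem_ofPred_eq] at hξ hη ⊢
    rw [integral_congr_ae (Lp.coeFn_add ξ η)]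
    simp only [Pi.add_apply]
    rw [integral_add h1 h2, hξ, hη, add_zero]
  smul_mem' := by
    intro c ξ hξ
    rw [Set.mem_ofPred_eq] at hξ ⊢
    rw [integral_congr_ae (Lp.coeFn_smul c ξ)]
    simp only [Pi.smul_apply]
    rw [integral_smul, hξ, smul_zero]

lemma rightRegular_mem_L2Zero (hμ : IsInvariantVolume Γ μ) (g : G) (ξ : Lp ℂ 2 μ)
    (hξ : ξ ∈ L2Zero hμ) : rightRegular hμ g ξ ∈ L2Zero hμ := by
  change ∫ y, (rightRegular hμ g ξ) y ∂μ = 0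
  change ∫ y, ξ y ∂μ = 0 at hξ
  rw [integral_congr_ae (rightRegular_coeFn hμ g ξ)]
  have hm := hμ.measurePreserving g
  have key : ∫ y, ξ (RightCosets.translate Γ g y) ∂μ =
      ∫ y, ξ y ∂(μ.map (RightCosets.translate Γ g)) := by
    refine (integral_map hm.measurable.aemeasurable ?_).symm
    rw [hm.map_eq]
    exact Lp.aestronglyMeasurable ξ
  rw [key, hm.map_eq, hξ]

/-- The restriction of the right regular representation to `L²₀(Γ \ G, μ)`. -/
noncomputable def rightRegularZero (hμ : IsInvariantVolume Γ μ) :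
    G →* (L2Zero hμ →ₗᵢ[ℂ] L2Zero hμ) where
  toFun g :=
    { toLinearMap := (rightRegular hμ g).toLinearMap.restrict
        (fun ξ hξ => rightRegular_mem_L2Zero hμ g ξ hξ)
      norm_map' := fun ξ => (rightRegular hμ g).norm_map (ξ : Lp ℂ 2 μ) }
  map_one' := by
    ext1 ξ
    apply Subtype.ext
    change rightRegular hμ 1 (ξ : Lp ℂ 2 μ) = ξ
    rw [map_one]
    rfl
  map_mul' g h := by
    ext1 ξ
    apply Subtype.ext
    change rightRegular hμ (g * h) (ξ : Lp ℂ 2 μ) = rightRegular hμ g (rightRegular hμ h ξ)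
    rw [map_mul]
    rfl

/-- `L²(Γ \ G, μ)` has a spectral gap. -/
def HasSpectralGap (hμ : IsInvariantVolume Γ μ) : Prop :=
  ¬ HasAlmostInvariantVectors (rightRegularZero hμ)

end Regular

end Representation

/-! ### Graphs with oriented edges, and diagrams -/

/-- A graph with vertex set `V` and set of oriented edges `E` (loops and multiple edges are
allowed). -/
structure OrientedGraph (V E : Type*) where
  /-- reversal of edges -/
  rev : E → E
  rev_rev : ∀ e, rev (rev e) = e
  rev_ne : ∀ e, rev e ≠ e
  /-- origin of an edge -/
  src : E → V
  /-- terminus of an edge -/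
  tgt : E → V
  src_rev : ∀ e, src (rev e) = tgt e

/-- A graph with a weight function `i` on the edges and a function `μ` on vertices and edges. -/
structure WeightedDiagram (V E : Type*) extends OrientedGraph V E where
  /-- the weight function -/
  i : E → ℝ≥0
  /-- the measure of a vertex -/
  μV : V → ℝ≥0
  /-- the measure of an edge -/
  μE : E → ℝ≥0

namespace WeightedDiagram

variable {V E : Type*} (D : WeightedDiagram V E)

/-- `D` is a diagram of finite volume: `i` is positive and `μ` is a (positive) measure for the
edge-indexed graph `(D, i)` with finite total mass. -/
structure IsFiniteVolume : Prop where
  i_pos : ∀ e, 0 < D.i e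
  μV_pos : ∀ x, 0 < D.μV x
  μE_pos : ∀ e, 0 < D.μE e
  i_mul : ∀ e, D.i e * D.μV (D.src e) = D.μE e
  μE_rev : ∀ e, D.μE e = D.μE (D.rev e)
  summable : Summable D.μV

/-- `μ(S)` for a set `S` of vertices. -/
noncomputable def vol (S : Set V) : ℝ≥0∞ := ∑' x : S, (D.μV x : ℝ≥0∞)

/-- `μ(F)` for a set `F` of edges. -/
noncomputable def edgeVol (F : Set E) : ℝ≥0∞ := ∑' e : F, (D.μE e : ℝ≥0∞)

/-- The edges from `S` to its complement. -/
def boundary (S : Set V) : Set E := {e | D.src e ∈ S ∧ D.tgt e ∉ S}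

/-- `D` is an expander diagram. -/
def IsExpander : Prop :=
  ∃ ε : ℝ≥0, 0 < ε ∧ ∀ S : Set V, S.Nonempty → D.vol S ≤ D.vol Set.univ / 2 →
    (ε : ℝ≥0∞) ≤ D.edgeVol (D.boundary S) / D.vol S

end WeightedDiagram

/-! ### Automorphism groups of graphs -/

section Graph

variable {V : Type*} {X : SimpleGraph V}

/-- The topology of pointwise convergence on `Aut(X)`, where `V` is discrete. -/
instance autTopology : TopologicalSpace (X ≃g X) :=
  TopologicalSpace.induced (fun g (x : V) => g x) (@Pi.topologicalSpace V (fun _ => V) fun _ => ⊥)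

lemma autTopology_continuous_iff {Y : Type*} [TopologicalSpace Y] {f : Y → (X ≃g X)} :
    Continuous f ↔ ∀ x y : V, IsOpen {t | f t x = y} := by
  let _ : TopologicalSpace V := ⊥
  have : DiscreteTopology V := ⟨rfl⟩
  rw [continuous_induced_rng, continuous_pi_iff]
  refine forall_congr' fun x => ?_
  rw [continuous_discrete_rng]
  rfl

lemma autTopology_isOpen (x y : V) : IsOpen {g : X ≃g X | g x = y} :=
  autTopology_continuous_iff.1 continuous_id x y

instance autTopologicalGroup : IsTopologicalGroup (X ≃g X) where
  continuous_mul := by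
    rw [autTopology_continuous_iff]
    intro x y
    have : {t : (X ≃g X) × (X ≃g X) | (t.1 * t.2) x = y} =
        ⋃ z : V, {g : X ≃g X | g z = y} ×ˢ {g : X ≃g X | g x = z} := by
      ext t
      simp [RelIso.mul_apply]
    rw [this]
    exact isOpen_iUnion fun z => (autTopology_isOpen z y).prod (autTopology_isOpen x z)
  continuous_inv := by
    rw [autTopology_continuous_iff]
    intro x y
    have : {g : X ≃g X | g⁻¹ x = y} = {g : X ≃g X | g y = x} := by
      ext g
      constructor
      · rintro h
        rw [Set.mem_ofPred_eq, ← (show g⁻¹ x = y from h), RelIso.apply_inv_self]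
      · rintro h
        rw [Set.mem_ofPred_eq, ← (show g y = x from h), RelIso.inv_apply_self]
    rw [this]
    exact autTopology_isOpen y x

/-- The action of `Aut(X)` on the oriented edges of `X`. -/
instance autDartAction : MulAction (X ≃g X) X.Dart where
  smul g e := g.toHom.mapDart e
  one_smul _ := rfl
  mul_smul _ _ _ := rfl

/-- Any two points of `S` are in the same `G`-orbit. -/
def ActsTransitivelyOn (G : Subgroup (X ≃g X)) (S : Set V) : Prop :=
  ∀ x ∈ S, ∀ y ∈ S, ∃ g ∈ G, g x = y

/-- The action on `X` is locally `∞`-transitive: vertex stabilizers act transitively on spheres. -/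
def IsLocallyInftyTransitive (G : Subgroup (X ≃g X)) : Prop :=
  ∀ (x : V) (n : ℕ), 1 ≤ n → ∀ y z : V, X.dist x y = n → X.dist x z = n →
    ∃ g ∈ G, g x = x ∧ g y = z

/-- `X` is bi-partite and bi-regular, with classes `V₀`, `V₁` of vertices of degrees `k₀`, `k₁`. -/
structure IsBiregularWith (X : SimpleGraph V) [X.LocallyFinite] (V₀ V₁ : Set V) (k₀ k₁ : ℕ) :
    Prop where
  bipartite : X.IsBipartiteWith V₀ V₁
  cover : V₀ ∪ V₁ = Set.univ
  degree₀ : ∀ x ∈ V₀, X.degree x = k₀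
  degree₁ : ∀ x ∈ V₁, X.degree x = k₁

variable {G : Subgroup (X ≃g X)} (Γ : Subgroup G)

/-- No element of `Γ` maps an edge to its reversed edge. -/
def ActsWithoutInversion : Prop := ∀ γ ∈ Γ, ∀ e : X.Dart, γ • e ≠ e.symm

/-! ### The quotient diagram `Γ \ X` -/

/-- The vertices of `Γ \ X`. -/
abbrev QuotientVertex : Type _ := MulAction.orbitRel.Quotient Γ V

/-- The oriented edges of `Γ \ X`. -/
abbrev QuotientEdge : Type _ := MulAction.orbitRel.Quotient Γ X.Dart

lemma smul_dart_symm (γ : Γ) (e : X.Dart) : (γ • e).symm = γ • e.symm := rfl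

lemma smul_dart_fst (γ : Γ) (e : X.Dart) : (γ • e).fst = γ • e.fst := rfl

lemma smul_dart_snd (γ : Γ) (e : X.Dart) : (γ • e).snd = γ • e.snd := rfl

/-- The quotient graph `Γ \ X`. -/
def quotientGraph (h : ActsWithoutInversion Γ) :
    OrientedGraph (QuotientVertex Γ) (QuotientEdge Γ) where
  rev := Quotient.map (fun e : X.Dart => e.symm) (by
    rintro _ b ⟨γ, rfl⟩
    exact ⟨γ, rfl⟩)
  rev_rev := by
    intro q
    induction q using Quotient.inductionOn with
    | h e => exact congrArg (Quotient.mk _) e.symm_symm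
  rev_ne := by
    intro q
    induction q using Quotient.inductionOn with
    | h e =>
      intro hq
      obtain ⟨γ, hγ⟩ := Quotient.exact hq
      exact h γ γ.2 e hγ
  src := Quotient.map (fun e : X.Dart => e.fst) (by
    rintro _ b ⟨γ, rfl⟩
    exact ⟨γ, rfl⟩)
  tgt := Quotient.map (fun e : X.Dart => e.snd) (by
    rintro _ b ⟨γ, rfl⟩
    exact ⟨γ, rfl⟩)
  src_rev := by
    intro q
    induction q using Quotient.inductionOn with
    | h e => rfl

lemma card_stabilizer_smul {H α : Type*} [Group H] [MulAction H α] (γ : H) (a : α) :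
    Nat.card (MulAction.stabilizer H (γ • a)) = Nat.card (MulAction.stabilizer H a) :=
  Nat.card_congr (MulAction.stabilizerEquivStabilizerOfOrbitRel ⟨γ, rfl⟩).toEquiv

lemma relIndex_stabilizer_smul {H α β : Type*} [Group H] [MulAction H α] [MulAction H β]
    (γ : H) (a : α) (b : β) :
    (MulAction.stabilizer H (γ • a)).relIndex (MulAction.stabilizer H (γ • b)) =
      (MulAction.stabilizer H a).relIndex (MulAction.stabilizer H b) := by
  rw [MulAction.stabilizer_smul_eq_stabilizer_map_conj,
    MulAction.stabilizer_smul_eq_stabilizer_map_conj]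
  exact Subgroup.relIndex_map_map_of_injective _ _ (MulAut.conj γ).injective

/-- The diagram `Γ \ X`: the quotient graph, with `i(e) = [Γ_x : Γ_e]` for `x` the origin of `e`,
`μ(x) = 1 / |Γ_x|` and `μ(e) = 1 / |Γ_e|`. -/
noncomputable def quotientDiagram (h : ActsWithoutInversion Γ) :
    WeightedDiagram (QuotientVertex Γ) (QuotientEdge Γ) where
  toOrientedGraph := quotientGraph Γ h
  i := Quotient.lift (fun e : X.Dart =>
      (((MulAction.stabilizer Γ e).relIndex (MulAction.stabilizer Γ e.fst) : ℕ) : ℝ≥0)) (by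
    rintro _ b ⟨γ, rfl⟩
    exact congrArg Nat.cast (relIndex_stabilizer_smul γ b b.fst))
  μV := Quotient.lift (fun x : V => 1 / (Nat.card (MulAction.stabilizer Γ x) : ℝ≥0)) (by
    rintro _ b ⟨γ, rfl⟩
    exact congrArg (fun n : ℕ => 1 / (n : ℝ≥0)) (card_stabilizer_smul γ b))
  μE := Quotient.lift (fun e : X.Dart => 1 / (Nat.card (MulAction.stabilizer Γ e) : ℝ≥0)) (by
    rintro _ b ⟨γ, rfl⟩
    exact congrArg (fun n : ℕ => 1 / (n : ℝ≥0)) (card_stabilizer_smul γ b))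

end Graph

/-!
Fix an edge of `X` with end points `a`, `b`. A function `f` on the vertices of `Γ \ X` lifts to the
two functions `Γ z ↦ f (Γ z a)` and `Γ z ↦ f (Γ z b)` on `Γ \ G`, which are right invariant under
the stabilizers of `a` and `b` respectively. The proof compares the diagram with `Γ \ G` through these lifts, which
treats the regular and the biregular case uniformly. Transitivity enters through the action of
vertex stabilizers on the set of neighbours of the vertex.

*Volumes.* For a finite invariant measure `μ` on `Γ \ G`, unfolding defines a right invariant mass
of open subsets of `G`. Local transitivity relates the masses of the transporters
`{g | g a = x}`, `{g | g b = x'}` and `{g | g a = x, g b = x'}` for adjacent `x`, `x'`, and it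
follows that the sum of the masses of the transporters from the edge `(a, b)` and its reverse to an
oriented edge `e` is a constant `C`, the same for all `e` (`unfoldedMass_add_eq`). Dividing by orders of
stabilizers, the measure of the boundary of a set `S` of vertices of the diagram is, up to `C`, the
measure of the set where the two lifts of the indicator function of `S` differ, and the volume of
`S` is comparable to the sum of their integrals (`exists_volume_comparison`). Finiteness of the
volume is an immediate consequence.

*A spectral gap implies expansion.* If `S` has small boundary, the lift of its indicator function
via `a` is moved little by `g`: one passes from `a` to `g a` along a path, each step of which costs
the measure of the boundary. Centering gives almost invariant vectors
(`hasAlmostInvariantVectors_of_not_isExpander`).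

*Expansion implies a spectral gap.* Averaging an almost invariant vector over the compact
stabilizers of `a` and `b` yields a function on the diagram whose two lifts are close to the vector,
hence to each other (`exists_average`, `exists_function_on_diagram`). Cheeger's inequality, proved
directly for the pair of lifts (`cheeger_real`, `poincare_real`), shows that the lifts are close to
a constant, which is impossible for a unit vector orthogonal to the constants.
-/

/-! ### A Cheeger inequality -/

section Cheeger

lemma exists_median {α : Type*} [MeasurableSpace α] (m : Measure α) [IsFiniteMeasure m]
    {f : α → ℝ} (hf : Measurable f) :
    ∃ c : ℝ, m {x | c < f x} ≤ m Set.univ / 2 ∧ m {x | f x < c} ≤ m Set.univ / 2 := by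
  rcases eq_or_ne m 0 with rfl | hm
  · exact ⟨0, by simp, by simp⟩
  set M := m Set.univ with hM
  have hM0 : M ≠ 0 := by simpa [hM] using hm
  have hMt : M ≠ ∞ := measure_ne_top _ _
  have hhalf : M / 2 < M := ENNReal.half_lt_self hM0 hMt
  have hlim : Filter.Tendsto (fun t : ℝ => m {x | f x ≤ t}) Filter.atTop (𝓝 M) := by
    have h := tendsto_measure_Iic_atTop (m.map f)
    rw [Measure.map_apply hf .univ, Set.preimage_univ] at h
    refine h.congr fun t => ?_
    rw [Measure.map_apply hf measurableSet_Iic]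
    rfl
  have hlim' : Filter.Tendsto (fun t : ℝ => m {x | t ≤ f x}) Filter.atBot (𝓝 M) := by
    have h := tendsto_measure_Ici_atBot (m.map f)
    rw [Measure.map_apply hf .univ, Set.preimage_univ] at h
    refine h.congr fun t => ?_
    rw [Measure.map_apply hf measurableSet_Ici]
    rfl
  have hcompl : ∀ t : ℝ, M / 2 ≤ m {x | f x ≤ t} → m {x | t < f x} ≤ M / 2 := by
    intro t ht
    have h1 : {x | t < f x} = {x | f x ≤ t}ᶜ := by ext x; simp
    rw [h1, measure_compl (measurableSet_le hf measurable_const) (measure_ne_top _ _)]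
    calc M - m {x | f x ≤ t} ≤ M - M / 2 := tsub_le_tsub_left ht _
      _ = M / 2 := ENNReal.sub_half hMt
  have hcompl' : ∀ t : ℝ, M / 2 ≤ m {x | t < f x} → m {x | f x ≤ t} ≤ M / 2 := by
    intro t ht
    have h1 : {x | f x ≤ t} = {x | t < f x}ᶜ := by ext x; simp
    rw [h1, measure_compl (measurableSet_lt measurable_const hf) (measure_ne_top _ _)]
    calc M - m {x | t < f x} ≤ M - M / 2 := tsub_le_tsub_left ht _
      _ = M / 2 := ENNReal.sub_half hMt
  set T : Set ℝ := {t | m {x | t < f x} ≤ M / 2} with hT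
  have hTne : T.Nonempty := by
    obtain ⟨t, ht⟩ := (hlim.eventually (lt_mem_nhds hhalf)).exists
    exact ⟨t, hcompl t ht.le⟩
  have hTbdd : BddBelow T := by
    obtain ⟨t, ht⟩ := (hlim'.eventually (lt_mem_nhds hhalf)).exists
    refine ⟨t, fun s hs => ?_⟩
    by_contra! hst
    refine absurd (ht.trans_le ((measure_mono ?_).trans hs)) (lt_irrefl _)
    exact fun x hx => hst.trans_le hx
  refine ⟨sInf T, ?_, ?_⟩
  · have h1 : {x | sInf T < f x} = ⋃ n : ℕ, {x | sInf T + 1 / ((n : ℝ) + 1) < f x} := by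
      ext x
      simp only [Set.mem_ofPred_eq, Set.mem_iUnion]
      constructor
      · intro hx
        obtain ⟨n, hn⟩ := exists_nat_one_div_lt (sub_pos.2 hx)
        exact ⟨n, by linarith⟩
      · rintro ⟨n, hn⟩
        have : (0 : ℝ) < 1 / ((n : ℝ) + 1) := Nat.one_div_pos_of_nat
        linarith
    rw [h1, Monotone.measure_iUnion]
    · refine iSup_le fun n => ?_
      have hpos : (0 : ℝ) < 1 / ((n : ℝ) + 1) := Nat.one_div_pos_of_nat
      obtain ⟨t, htT, ht⟩ := exists_lt_of_csInf_lt hTne (lt_add_of_pos_right (sInf T) hpos)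
      exact (measure_mono fun x hx => ht.trans hx).trans htT
    · intro i j hij x hx
      have := Nat.one_div_le_one_div (α := ℝ) hij
      simp only [Set.mem_ofPred_eq] at hx ⊢
      linarith
  · have h1 : {x | f x < sInf T} = ⋃ n : ℕ, {x | f x ≤ sInf T - 1 / ((n : ℝ) + 1)} := by
      ext x
      simp only [Set.mem_ofPred_eq, Set.mem_iUnion]
      constructor
      · intro hx
        obtain ⟨n, hn⟩ := exists_nat_one_div_lt (sub_pos.2 hx)
        exact ⟨n, by linarith⟩
      · rintro ⟨n, hn⟩
        have : (0 : ℝ) < 1 / ((n : ℝ) + 1) := Nat.one_div_pos_of_nat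
        linarith
    rw [h1, Monotone.measure_iUnion]
    · refine iSup_le fun n => hcompl' _ ?_
      have hpos : (0 : ℝ) < 1 / ((n : ℝ) + 1) := Nat.one_div_pos_of_nat
      have hn : sInf T - 1 / ((n : ℝ) + 1) ∉ T := notMem_of_lt_csInf (by linarith) hTbdd
      exact (not_le.1 hn).le
    · intro i j hij x hx
      have := Nat.one_div_le_one_div (α := ℝ) hij
      simp only [Set.mem_ofPred_eq] at hx ⊢
      linarith

variable {Ω : Type*} [MeasurableSpace Ω] {μ : Measure Ω}

/-- The co-area argument: an isoperimetric inequality for the pairs of superlevel sets of `w`, `w'`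
integrates, by the layer cake formula, to a Poincaré inequality in `L¹`. Here `|w - w'|` is written
as `max w w' - min w w'`, whose superlevel sets are the union and the intersection. -/
lemma isoperimetric_integral_le {w w' : Ω → ℝ} (hw : Measurable w) (hw' : Measurable w')
    (hwi : Integrable w μ) (hwi' : Integrable w' μ) (hw0 : ∀ z, 0 ≤ w z) (hw0' : ∀ z, 0 ≤ w' z)
    {κ : ℝ≥0}
    (h : ∀ t : ℝ, 0 < t → κ * (μ {z | t < w z} + μ {z | t < w' z}) ≤
      μ {z | t < w z ∧ ¬ t < w' z} + μ {z | t < w' z ∧ ¬ t < w z}) :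
    κ * ((∫ z, w z ∂μ) + ∫ z, w' z ∂μ) ≤ ∫ z, |w z - w' z| ∂μ := by
  have key : ∀ t : ℝ, 0 < t → κ * (μ {z | t < w z} + μ {z | t < w' z}) +
      μ {z | t < min (w z) (w' z)} ≤ μ {z | t < max (w z) (w' z)} := by
    intro t ht
    have mA : MeasurableSet {z | t < w z} := measurableSet_lt measurable_const hw
    have mB : MeasurableSet {z | t < w' z} := measurableSet_lt measurable_const hw'
    have e1 : {z | t < max (w z) (w' z)} = ({z | t < w z ∧ ¬ t < w' z} ∪
        {z | t < w' z ∧ ¬ t < w z}) ∪ {z | t < min (w z) (w' z)} := by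
      ext z
      simp only [Set.mem_ofPred_eq, Set.mem_union, lt_max_iff, lt_min_iff]
      tauto
    rw [e1, measure_union, measure_union]
    · gcongr
      exact h t ht
    · exact Set.disjoint_left.2 fun z h1 h2 => h1.2 h2.1
    · exact mB.inter mA.compl
    · refine Set.disjoint_left.2 fun z h1 h2 => ?_
      have h2 := lt_min_iff.1 (show t < min (w z) (w' z) from h2)
      exact h1.elim (fun h => h.2 h2.2) fun h => h.2 h2.1
    · exact measurableSet_lt measurable_const (hw.min hw')
  have cake : ∀ {f : Ω → ℝ}, Measurable f → (∀ z, 0 ≤ f z) →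
      ∫⁻ z, ENNReal.ofReal (f z) ∂μ = ∫⁻ t in Set.Ioi (0 : ℝ), μ {z | t < f z} := fun hf h0 =>
    lintegral_eq_lintegral_meas_lt μ (Filter.Eventually.of_forall h0) hf.aemeasurable
  have mono : ∀ f : Ω → ℝ, Measurable fun t : ℝ => μ {z | t < f z} := fun f =>
    Antitone.measurable fun s t hst => measure_mono fun z hz => hst.trans_lt hz
  have main : κ * ((∫⁻ z, ENNReal.ofReal (w z) ∂μ) + ∫⁻ z, ENNReal.ofReal (w' z) ∂μ) +
      ∫⁻ z, ENNReal.ofReal (min (w z) (w' z)) ∂μ ≤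
      ∫⁻ z, ENNReal.ofReal (max (w z) (w' z)) ∂μ := by
    rw [cake hw hw0, cake hw' hw0', cake (hw.min hw') fun z => le_min (hw0 z) (hw0' z),
      cake (hw.max hw') fun z => (hw0 z).trans (le_max_left _ _),
      ← lintegral_add_left (mono w), ← lintegral_const_mul' _ _ ENNReal.coe_ne_top,
      ← lintegral_add_right _ (mono _)]
    exact setLIntegral_mono (mono _) fun t ht => key t ht
  have hmin : Integrable (fun z => min (w z) (w' z)) μ := hwi.inf hwi'
  have hmax : Integrable (fun z => max (w z) (w' z)) μ := hwi.sup hwi'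
  have conv : ∀ {f : Ω → ℝ}, Integrable f μ → (∀ z, 0 ≤ f z) →
      ∫⁻ z, ENNReal.ofReal (f z) ∂μ = ENNReal.ofReal (∫ z, f z ∂μ) := fun hf h0 =>
    (ofReal_integral_eq_lintegral_ofReal hf (Filter.Eventually.of_forall h0)).symm
  have n1 : 0 ≤ ∫ z, w z ∂μ := integral_nonneg hw0
  have n2 : 0 ≤ ∫ z, w' z ∂μ := integral_nonneg hw0'
  have n3 : 0 ≤ ∫ z, min (w z) (w' z) ∂μ := integral_nonneg fun z => le_min (hw0 z) (hw0' z)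
  have n4 : 0 ≤ ∫ z, max (w z) (w' z) ∂μ :=
    integral_nonneg fun z => (hw0 z).trans (le_max_left _ _)
  rw [conv hwi hw0, conv hwi' hw0', conv hmin fun z => le_min (hw0 z) (hw0' z),
    conv hmax fun z => (hw0 z).trans (le_max_left _ _), ← ENNReal.ofReal_add n1 n2,
    ← ENNReal.ofReal_coe_nnreal, ← ENNReal.ofReal_mul κ.coe_nonneg,
    ← ENNReal.ofReal_add (mul_nonneg κ.coe_nonneg (add_nonneg n1 n2)) n3,
    ENNReal.ofReal_le_ofReal_iff n4] at main
  have : ∫ z, |w z - w' z| ∂μ = (∫ z, max (w z) (w' z) ∂μ) - ∫ z, min (w z) (w' z) ∂μ := by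
    rw [← integral_sub hmax hmin]
    exact integral_congr_ae (Filter.Eventually.of_forall fun z => (max_sub_min_eq_abs' _ _).symm)
  linarith

/-- The `L²` inequality for nonnegative functions, from the `L¹` inequality for their squares. -/
lemma cheeger_of_nonneg {u v : Ω → ℝ} (hu : Measurable u) (hv : Measurable v)
    (hu2 : MemLp u 2 μ) (hv2 : MemLp v 2 μ) (hu0 : ∀ z, 0 ≤ u z) (hv0 : ∀ z, 0 ≤ v z)
    {κ : ℝ≥0} (hκ : 0 < κ)
    (h : ∀ t : ℝ, 0 < t → κ * (μ {z | t < u z} + μ {z | t < v z}) ≤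
      μ {z | t < u z ∧ ¬ t < v z} + μ {z | t < v z ∧ ¬ t < u z}) :
    (κ : ℝ) ^ 2 * ((∫ z, u z ^ 2 ∂μ) + ∫ z, v z ^ 2 ∂μ) ≤ 2 * ∫ z, (u z - v z) ^ 2 ∂μ := by
  have iu : Integrable (fun z => u z ^ 2) μ := hu2.integrable_sq
  have iv : Integrable (fun z => v z ^ 2) μ := hv2.integrable_sq
  have iuv : Integrable (fun z => (u z - v z) ^ 2) μ := (hu2.sub hv2).integrable_sq
  have lvl : ∀ {f : Ω → ℝ}, (∀ z, 0 ≤ f z) → ∀ {t : ℝ}, 0 < t → ∀ z, t < f z ^ 2 ↔ √t < f z :=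
    fun h0 t ht z => by
      rw [← Real.sqrt_lt_sqrt_iff ht.le, Real.sqrt_sq (h0 z)]
  have h1 : κ * ((∫ z, u z ^ 2 ∂μ) + ∫ z, v z ^ 2 ∂μ) ≤ ∫ z, |u z ^ 2 - v z ^ 2| ∂μ := by
    refine isoperimetric_integral_le (hu.pow_const 2) (hv.pow_const 2) iu iv
      (fun z => sq_nonneg _) (fun z => sq_nonneg _) fun t ht => ?_
    simp only [lvl hu0 ht, lvl hv0 ht]
    exact h _ (Real.sqrt_pos.2 ht)
  have hκ' : (0 : ℝ) < κ := hκ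
  -- `|u² - v²| = |u - v| (u + v)`, and the product is split with weights chosen to absorb `u² + v²`
  have h2 : ∫ z, |u z ^ 2 - v z ^ 2| ∂μ ≤
      ∫ z, ((κ : ℝ)⁻¹ * (u z - v z) ^ 2 + κ / 2 * (u z ^ 2 + v z ^ 2)) ∂μ := by
    refine integral_mono (iu.sub iv).abs ((iuv.const_mul _).add ((iu.add iv).const_mul _))
      fun z => ?_
    have e : |u z ^ 2 - v z ^ 2| = |u z - v z| * (u z + v z) := by
      rw [← abs_of_nonneg (add_nonneg (hu0 z) (hv0 z)), ← abs_mul]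
      congr 1
      ring
    have e2 : (κ : ℝ) * (κ : ℝ)⁻¹ = 1 := mul_inv_cancel₀ hκ'.ne'
    simp only
    rw [e]
    have s1 := sq_nonneg (|u z - v z| - κ / 2 * (u z + v z))
    have s2 := sq_nonneg (u z - v z)
    have s3 : |u z - v z| ^ 2 = (u z - v z) ^ 2 := sq_abs _
    have : κ * (|u z - v z| * (u z + v z)) ≤
        κ * ((κ : ℝ)⁻¹ * (u z - v z) ^ 2 + κ / 2 * (u z ^ 2 + v z ^ 2)) := by
      rw [mul_add (κ : ℝ) (_⁻¹ * _), ← mul_assoc (κ : ℝ) _⁻¹, e2]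
      have s4 : 0 ≤ (κ : ℝ) ^ 2 * (u z - v z) ^ 2 := by positivity
      nlinarith
    exact le_of_mul_le_mul_left this hκ'
  have h3 : ∫ z, ((κ : ℝ)⁻¹ * (u z - v z) ^ 2 + κ / 2 * (u z ^ 2 + v z ^ 2)) ∂μ =
      (κ : ℝ)⁻¹ * (∫ z, (u z - v z) ^ 2 ∂μ) +
        κ / 2 * ((∫ z, u z ^ 2 ∂μ) + ∫ z, v z ^ 2 ∂μ) := by
    rw [← integral_add iu iv, ← integral_const_mul, ← integral_const_mul]
    exact integral_add (iuv.const_mul _) ((iu.add iv).const_mul _)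
  rw [h3] at h2
  have h4 : (κ : ℝ) / 2 * ((∫ z, u z ^ 2 ∂μ) + ∫ z, v z ^ 2 ∂μ) ≤
      (κ : ℝ)⁻¹ * ∫ z, (u z - v z) ^ 2 ∂μ := by linarith
  have h5 := mul_le_mul_of_nonneg_left h4 (by positivity : (0 : ℝ) ≤ 2 * κ)
  calc (κ : ℝ) ^ 2 * ((∫ z, u z ^ 2 ∂μ) + ∫ z, v z ^ 2 ∂μ)
      = 2 * κ * ((κ : ℝ) / 2 * ((∫ z, u z ^ 2 ∂μ) + ∫ z, v z ^ 2 ∂μ)) := by ring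
    _ ≤ _ := h5
    _ = _ := by field_simp

variable [IsFiniteMeasure μ]

/-- Cheeger's inequality for a pair of functions. In the application `c` is a median, which is what
makes the isoperimetric hypotheses available above and below `c` respectively; they are applied to
the positive and the negative parts of `u - c` and `v - c`. -/
lemma cheeger_real {u v : Ω → ℝ} (hu : Measurable u) (hv : Measurable v)
    (hu2 : MemLp u 2 μ) (hv2 : MemLp v 2 μ) {κ : ℝ≥0} (hκ : 0 < κ) (c : ℝ)
    (h : ∀ t : ℝ, c ≤ t → κ * (μ {z | t < u z} + μ {z | t < v z}) ≤
      μ {z | t < u z ∧ ¬ t < v z} + μ {z | t < v z ∧ ¬ t < u z})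
    (h' : ∀ t : ℝ, t ≤ c → κ * (μ {z | u z < t} + μ {z | v z < t}) ≤
      μ {z | u z < t ∧ ¬ v z < t} + μ {z | v z < t ∧ ¬ u z < t}) :
    (κ : ℝ) ^ 2 * ((∫ z, (u z - c) ^ 2 ∂μ) + ∫ z, (v z - c) ^ 2 ∂μ) ≤
      4 * ∫ z, (u z - v z) ^ 2 ∂μ := by
  have hc : MemLp (fun _ : Ω => c) 2 μ := memLp_const c
  have mp : ∀ {f : Ω → ℝ}, MemLp f 2 μ → MemLp (fun z => max (f z - c) 0) 2 μ := fun hf =>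
    (hf.sub hc).pos_part
  have mn : ∀ {f : Ω → ℝ}, MemLp f 2 μ → MemLp (fun z => max (c - f z) 0) 2 μ := fun hf =>
    (hc.sub hf).pos_part
  have iuv : Integrable (fun z => (u z - v z) ^ 2) μ := (hu2.sub hv2).integrable_sq
  have hp := cheeger_of_nonneg ((hu.sub_const c).max measurable_const)
    ((hv.sub_const c).max measurable_const) (mp hu2) (mp hv2) (fun z => le_max_right _ _)
    (fun z => le_max_right _ _) hκ (fun t ht => by
      have e : ∀ x : ℝ, t < max (x - c) 0 ↔ c + t < x := fun x => by
        rw [lt_max_iff, or_iff_left ht.not_gt, lt_sub_iff_add_lt']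
      simp only [e]
      exact h _ (by linarith))
  have hn := cheeger_of_nonneg ((hu.const_sub c).max measurable_const)
    ((hv.const_sub c).max measurable_const) (mn hu2) (mn hv2)
    (fun z => le_max_right _ _)
    (fun z => le_max_right _ _) hκ (fun t ht => by
      have e : ∀ x : ℝ, t < max (c - x) 0 ↔ x < c - t := fun x => by
        rw [lt_max_iff, or_iff_left ht.not_gt]
        constructor <;> intro <;> linarith
      simp only [e]
      exact h' _ (by linarith))
  have split : ∀ {f : Ω → ℝ}, MemLp f 2 μ → ∫ z, (f z - c) ^ 2 ∂μ =
      (∫ z, (max (f z - c) 0) ^ 2 ∂μ) + ∫ z, (max (c - f z) 0) ^ 2 ∂μ := by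
    intro f hf
    rw [← integral_add (mp hf).integrable_sq (mn hf).integrable_sq]
    refine integral_congr_ae (Filter.Eventually.of_forall fun z => ?_)
    simp only
    rcases le_total (f z) c with h | h
    · rw [max_eq_right (by linarith), max_eq_left (by linarith)]; ring
    · rw [max_eq_left (by linarith), max_eq_right (by linarith)]; ring
  have b1 : ∫ z, (max (u z - c) 0 - max (v z - c) 0) ^ 2 ∂μ ≤ ∫ z, (u z - v z) ^ 2 ∂μ := by
    refine integral_mono ((mp hu2).sub (mp hv2)).integrable_sq iuv fun z => ?_
    refine sq_le_sq.2 ((abs_max_sub_max_le_abs _ _ _).trans_eq ?_)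
    congr 1
    ring
  have b2 : ∫ z, (max (c - u z) 0 - max (c - v z) 0) ^ 2 ∂μ ≤ ∫ z, (u z - v z) ^ 2 ∂μ := by
    refine integral_mono ((mn hu2).sub (mn hv2)).integrable_sq iuv fun z => ?_
    refine sq_le_sq.2 ((abs_max_sub_max_le_abs _ _ _).trans_eq ?_)
    rw [abs_sub_comm]
    congr 1
    ring
  rw [split hu2, split hv2]
  linarith

end Cheeger

/-! ### The automorphism group of a locally finite connected graph -/

section Automorphisms

variable {V : Type*} {X : SimpleGraph V}

lemma finite_setOf_walk_length [X.LocallyFinite] (n : ℕ) (a : V) :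
    {x | ∃ p : X.Walk a x, p.length = n}.Finite := by
  induction n generalizing a with
  | zero =>
    refine (Set.finite_singleton a).subset ?_
    rintro x ⟨p, hp⟩
    exact (SimpleGraph.Walk.eq_of_length_eq_zero hp).symm
  | succ n ih =>
    refine ((X.neighborFinset a).finite_toSet.biUnion fun b _ => ih b).subset ?_
    rintro x ⟨p, hp⟩
    cases p with
    | nil => simp at hp
    | cons h p =>
      refine Set.mem_biUnion (by simpa using h) ⟨p, ?_⟩
      simpa using hp

lemma countable_of_connected [X.LocallyFinite] (hX : X.Connected) : Countable V := by
  obtain ⟨a⟩ := hX.nonempty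
  have : (⋃ n : ℕ, {x | ∃ p : X.Walk a x, p.length = n}) = Set.univ := by
    refine Set.eq_univ_of_forall fun x => ?_
    obtain ⟨p⟩ := hX.preconnected a x
    exact Set.mem_iUnion.2 ⟨p.length, p, rfl⟩
  rw [← Set.countable_univ_iff, ← this]
  exact Set.countable_iUnion fun n => (finite_setOf_walk_length n a).countable

lemma finite_orbit_of_fix [X.LocallyFinite] (hX : X.Connected) (a x : V) :
    {y | ∃ g : X ≃g X, g a = a ∧ g x = y}.Finite := by
  obtain ⟨p⟩ := hX.preconnected a x
  refine (finite_setOf_walk_length (X := X) p.length a).subset ?_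
  rintro y ⟨g, hga, rfl⟩
  refine ⟨(p.map g.toHom).copy hga rfl, ?_⟩
  simp

instance autT2Space : T2Space (X ≃g X) := by
  let _ : TopologicalSpace V := ⊥
  have : DiscreteTopology V := ⟨rfl⟩
  exact T2Space.of_injective_continuous (f := fun (g : X ≃g X) (x : V) => g x)
    DFunLike.coe_injective continuous_induced_dom

lemma secondCountable_aut [Countable V] : SecondCountableTopology (X ≃g X) := by
  let _ : TopologicalSpace V := ⊥
  have : DiscreteTopology V := ⟨rfl⟩
  exact TopologicalSpace.secondCountableTopology_induced (X ≃g X) (V → V) fun g x => g x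

/-- Vertex stabilizers in the full automorphism group are compact: along an ultrafilter, the image
and the preimage of each vertex range over a finite set, hence are eventually constant, and the
limits define an automorphism. -/
lemma isCompact_fix_aut [X.LocallyFinite] (hX : X.Connected) (a : V) :
    IsCompact {g : X ≃g X | g a = a} := by
  rw [isCompact_iff_ultrafilter_le_nhds]
  intro U hU
  have hS : {g : X ≃g X | g a = a} ∈ U := Filter.le_principal_iff.1 hU
  have h1 : ∀ x, ∃ y, {g : X ≃g X | g x = y} ∈ U := by
    intro x
    have : (⋃ y ∈ {y | ∃ g : X ≃g X, g a = a ∧ g x = y}, {g : X ≃g X | g x = y}) ∈ U := by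
      refine Filter.mem_of_superset hS fun g hg => ?_
      exact Set.mem_biUnion (⟨g, hg, rfl⟩ : g x ∈ {y | ∃ g : X ≃g X, g a = a ∧ g x = y}) rfl
    obtain ⟨y, -, hy⟩ := (Ultrafilter.finite_biUnion_mem_iff (finite_orbit_of_fix hX a x)).1 this
    exact ⟨y, hy⟩
  have h2 : ∀ x, ∃ y, {g : X ≃g X | g y = x} ∈ U := by
    intro x
    have : (⋃ y ∈ {y | ∃ g : X ≃g X, g a = a ∧ g x = y}, {g : X ≃g X | g y = x}) ∈ U := by
      refine Filter.mem_of_superset hS fun g hg => ?_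
      refine Set.mem_biUnion (x := g.symm x) ⟨g.symm, ?_, rfl⟩ (g.apply_symm_apply x)
      rw [← (show g a = a from hg), g.symm_apply_apply, show g a = a from hg]
    obtain ⟨y, -, hy⟩ := (Ultrafilter.finite_biUnion_mem_iff (finite_orbit_of_fix hX a x)).1 this
    exact ⟨y, hy⟩
  choose φ hφ using h1
  choose ψ hψ using h2
  let h : X ≃g X :=
    { toFun := φ
      invFun := ψ
      left_inv := fun x => by
        obtain ⟨g, hg1, hg2⟩ := U.nonempty_of_mem (Filter.inter_mem (hφ x) (hψ (φ x)))
        exact g.injective ((show g _ = _ from hg2).trans (show g _ = _ from hg1).symm)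
      right_inv := fun x => by
        obtain ⟨g, hg1, hg2⟩ := U.nonempty_of_mem (Filter.inter_mem (hφ (ψ x)) (hψ x))
        exact (show g _ = _ from hg1).symm.trans hg2
      map_rel_iff' := fun {x y} => by
        obtain ⟨g, hg1, hg2⟩ := U.nonempty_of_mem (Filter.inter_mem (hφ x) (hφ y))
        change X.Adj (φ x) (φ y) ↔ X.Adj x y
        rw [← (show g x = φ x from hg1), ← (show g y = φ y from hg2)]
        exact g.map_adj_iff }
  have hh : ∀ x, h x = φ x := fun x => rfl
  refine ⟨h, ?_, ?_⟩
  · obtain ⟨g, hg1, hg2⟩ := U.nonempty_of_mem (Filter.inter_mem hS (hφ a))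
    exact (show g a = h a from hg2).symm.trans hg1
  · let _ : TopologicalSpace V := ⊥
    have : DiscreteTopology V := ⟨rfl⟩
    rw [nhds_induced, ← Filter.map_le_iff_le_comap]
    change Filter.Tendsto (fun (g : X ≃g X) (x : V) => g x) U (𝓝 fun x => h x)
    rw [tendsto_pi_nhds]
    intro x
    rw [nhds_discrete, Filter.tendsto_pure]
    exact hφ x

variable {G : Subgroup (X ≃g X)}

lemma isOpen_setOf_apply_eq (a x : V) : IsOpen {g : G | (g : X ≃g X) a = x} :=
  (autTopology_isOpen a x).preimage continuous_subtype_val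

lemma isCompact_fix [X.LocallyFinite] (hX : X.Connected) (hG : IsClosed (G : Set (X ≃g X)))
    (a : V) : IsCompact {g : G | (g : X ≃g X) a = a} :=
  hG.isClosedEmbedding_subtypeVal.isCompact_preimage (isCompact_fix_aut hX a)

/-- The stabilizer of a vertex in `Γ` is finite, being discrete and compact. -/
lemma finite_stabilizer [X.LocallyFinite] (hX : X.Connected) (hG : IsClosed (G : Set (X ≃g X)))
    (Γ : Subgroup G) [DiscreteTopology Γ] (a : V) : Finite (MulAction.stabilizer Γ a) := by
  have hcl : IsClosed (Γ : Set G) := Subgroup.isClosed_of_discrete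
  have := (hcl.isClosedEmbedding_subtypeVal.isCompact_preimage
    (isCompact_fix hX hG a)).finite_of_discrete
  exact this.to_subtype

lemma finite_image_of_isCompact {Q : Set G} (hQ : IsCompact Q) (a : V) :
    {x | ∃ g ∈ Q, (g : X ≃g X) a = x}.Finite := by
  obtain ⟨t, ht⟩ := hQ.elim_finite_subcover (fun x : V => {g : G | (g : X ≃g X) a = x})
    (fun x => isOpen_setOf_apply_eq a x) fun g _ => Set.mem_iUnion.2 ⟨_, rfl⟩
  refine t.finite_toSet.subset ?_
  rintro x ⟨g, hg, rfl⟩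
  obtain ⟨y, hy, hgy⟩ := Set.mem_iUnion₂.1 (ht hg)
  rwa [show (g : X ≃g X) a = y from hgy]

/-- Vertex stabilizers act transitively on the set of neighbours. -/
def IsLocallyTransitive (G : Subgroup (X ≃g X)) : Prop :=
  ∀ x y z : V, X.Adj x y → X.Adj x z → ∃ g ∈ G, g x = x ∧ g y = z

lemma IsLocallyInftyTransitive.isLocallyTransitive (h : IsLocallyInftyTransitive G) :
    IsLocallyTransitive G := fun x y z hy hz =>
  h x 1 le_rfl y z (SimpleGraph.dist_eq_one_iff_adj.2 hy) (SimpleGraph.dist_eq_one_iff_adj.2 hz)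

/-- A locally transitive group acts transitively on the unoriented edges of a connected graph. -/
lemma IsLocallyTransitive.exists_edge (h : IsLocallyTransitive G) (hX : X.Connected) {a b : V}
    (hab : X.Adj a b) {x y : V} (hxy : X.Adj x y) :
    ∃ g : G, ((g : X ≃g X) a = x ∧ (g : X ≃g X) b = y) ∨
      ((g : X ≃g X) a = y ∧ (g : X ≃g X) b = x) := by
  obtain ⟨p⟩ := hX.preconnected a x
  induction p generalizing b y with
  | nil =>
    obtain ⟨g, hg, h1, h2⟩ := h _ _ _ hab hxy
    exact ⟨⟨g, hg⟩, Or.inl ⟨h1, h2⟩⟩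
  | @cons a c x hac p ih =>
    obtain ⟨g, hg, h1, h2⟩ := h _ _ _ hab hac
    obtain ⟨g', h'⟩ := ih hac.symm hxy
    refine ⟨g' * ⟨g, hg⟩, ?_⟩
    have e1 : ((g' * ⟨g, hg⟩ : G) : X ≃g X) a = (g' : X ≃g X) a := congrArg (g' : X ≃g X) h1
    have e2 : ((g' * ⟨g, hg⟩ : G) : X ≃g X) b = (g' : X ≃g X) c := congrArg (g' : X ≃g X) h2
    rw [e1, e2]
    tauto

end Automorphisms

/-! ### Unfolding integrals over `Γ \ G` -/

section Unfolding

variable {G : Type*} [Group G] [TopologicalSpace G] (Γ : Subgroup G)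

/-- The function `Γ z ↦ #{γ ∈ Γ | γ z ∈ W}` on `Γ \ G`. -/
noncomputable def cosetCount (W : Set G) : RightCosets Γ → ℝ≥0∞ :=
  Quotient.lift (fun z : G => ∑' γ : Γ, W.indicator (fun _ => (1 : ℝ≥0∞)) (γ * z)) (by
    intro z w h
    change QuotientGroup.rightRel Γ z w at h
    rw [QuotientGroup.rightRel_apply] at h
    refine Eq.trans ?_ ((Equiv.mulRight (⟨w * z⁻¹, h⟩ : Γ)⁻¹).tsum_eq _)
    refine tsum_congr fun γ => ?_
    congr 1
    simp [mul_assoc])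

lemma cosetCount_mk (W : Set G) (z : G) : cosetCount Γ W (RightCosets.mk Γ z) =
    ∑' γ : Γ, W.indicator (fun _ => (1 : ℝ≥0∞)) (γ * z) := rfl

lemma RightCosets.mk_surjective : Function.Surjective (RightCosets.mk Γ) := Quotient.mk_surjective

/-- The map `Γ z ↦ Γ (z • α)` from `Γ \ G` to the set of `Γ`-orbits, for a point `α` of a
`G`-set. -/
def orbitMap {Y : Type*} [MulAction G Y] (α : Y) :
    RightCosets Γ → MulAction.orbitRel.Quotient Γ Y :=
  Quotient.map (fun z : G => z • α) (by
    intro z w h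
    change QuotientGroup.rightRel Γ z w at h
    rw [QuotientGroup.rightRel_apply] at h
    refine ⟨(⟨w * z⁻¹, h⟩ : Γ)⁻¹, ?_⟩
    change ((w * z⁻¹)⁻¹) • w • α = z • α
    rw [smul_smul]
    simp)

lemma orbitMap_translate {Y : Type*} [MulAction G Y] (α : Y) (g : G) (q : RightCosets Γ) :
    orbitMap Γ α (RightCosets.translate Γ g q) = orbitMap Γ (g • α) q := by
  induction q using Quotient.inductionOn with
  | h z => exact congrArg (Quotient.mk _) (mul_smul z g α)

lemma isOpen_preimage_orbitMap {Y : Type*} [MulAction G Y] {α : Y}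
    (hα : ∀ y, IsOpen {g : G | g • α = y}) (S : Set (MulAction.orbitRel.Quotient Γ Y)) :
    IsOpen (orbitMap Γ α ⁻¹' S) := by
  change IsOpen {z : G | Quotient.mk _ (z • α) ∈ S}
  have : {z : G | Quotient.mk (MulAction.orbitRel Γ Y) (z • α) ∈ S} =
      ⋃ y ∈ {y | Quotient.mk (MulAction.orbitRel Γ Y) y ∈ S}, {g : G | g • α = y} := by
    ext z
    simp
  rw [this]
  exact isOpen_biUnion fun y _ => hα y

/-- For the transporter from `α` to `y`, the coset count takes a single nonzero value, the order of
the stabilizer of `y`. -/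
lemma cosetCount_orbit {Y : Type*} [MulAction G Y] (α y : Y) [Finite (MulAction.stabilizer Γ y)]
    (q : RightCosets Γ) : cosetCount Γ {g | g • α = y} q =
      (orbitMap Γ α ⁻¹' {Quotient.mk _ y}).indicator
        (fun _ => (Nat.card (MulAction.stabilizer Γ y) : ℝ≥0∞)) q := by
  classical
  obtain ⟨z, rfl⟩ := RightCosets.mk_surjective Γ q
  rw [cosetCount_mk]
  by_cases hz : ∃ γ₀ : Γ, γ₀ • z • α = y
  · obtain ⟨γ₀, h0⟩ := hz
    rw [Set.indicator_of_mem, ← (Equiv.mulRight γ₀).tsum_eq]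
    · have e : ∀ γ : Γ, ({g : G | g • α = y}.indicator (fun _ => (1 : ℝ≥0∞))
          (((Equiv.mulRight γ₀ γ : Γ) : G) * z)) =
          (MulAction.stabilizer Γ y : Set Γ).indicator (fun _ => 1) γ := by
        intro γ
        have : ((((Equiv.mulRight γ₀ γ : Γ) : G) * z) • α = y) ↔ γ • y = y := by
          rw [← h0]
          simp [mul_smul, Subgroup.smul_def]
        simp only [Set.indicator_apply, Set.mem_ofPred_eq, this, SetLike.mem_coe,
          MulAction.mem_stabilizer_iff]
      rw [tsum_congr e, ← tsum_subtype, ENNReal.tsum_const, mul_one]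
      change ((ENat.card (MulAction.stabilizer Γ y) : ℕ∞) : ℝ≥0∞) = _
      rw [ENat.card_eq_coe_natCard]
      rfl
    · exact Quotient.sound ⟨γ₀⁻¹, by rw [← h0]; exact inv_smul_smul _ _⟩
  · rw [Set.indicator_of_notMem, ENNReal.tsum_eq_zero]
    · intro γ
      refine Set.indicator_of_notMem (fun h => hz ⟨γ, ?_⟩) _
      rw [← show ((γ : G) * z) • α = y from h, mul_smul]
      rfl
    · intro h
      obtain ⟨γ, hγ⟩ := Quotient.exact h
      exact hz ⟨γ⁻¹, by rw [← show γ • y = z • α from hγ]; exact inv_smul_smul _ _⟩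

variable [IsTopologicalGroup G]

lemma measurable_cosetCount {W : Set G} (hW : IsOpen W) : Measurable (cosetCount Γ W) := by
  refine LowerSemicontinuous.measurable ?_
  have h : LowerSemicontinuous fun z : G =>
      ∑' γ : Γ, W.indicator (fun _ => (1 : ℝ≥0∞)) (γ * z) := by
    refine lowerSemicontinuous_tsum fun γ => ?_
    exact (hW.preimage (continuous_const_mul (γ : G))).lowerSemicontinuous_indicator zero_le_one
  rw [lowerSemicontinuous_iff_isOpen_preimage] at h ⊢
  exact fun t => h t

variable {Γ}

/-- The measure of an open subset of `G` obtained by unfolding the measure `μ` of `Γ \ G`. -/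
noncomputable def unfoldedMass (μ : Measure (RightCosets Γ)) (W : Set G) : ℝ≥0∞ :=
  ∫⁻ q, cosetCount Γ W q ∂μ

variable {μ : Measure (RightCosets Γ)}

lemma unfoldedMass_translate (hμ : IsInvariantVolume Γ μ) {W : Set G} (hW : IsOpen W) (g : G) :
    unfoldedMass μ {z | z * g ∈ W} = unfoldedMass μ W := by
  have e : cosetCount Γ {z | z * g ∈ W} = fun q =>
      cosetCount Γ W (RightCosets.translate Γ g q) := by
    funext q
    induction q using Quotient.inductionOn with
    | h z =>
      exact tsum_congr fun γ =>
        congrArg (W.indicator fun _ => (1 : ℝ≥0∞)) (mul_assoc (γ : G) z g)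
  rw [unfoldedMass, e]
  exact (hμ.measurePreserving g).lintegral_comp (measurable_cosetCount Γ hW)

lemma unfoldedMass_biUnion {ι : Type*} (s : Finset ι) (W : ι → Set G) (hW : ∀ i, IsOpen (W i))
    (hd : Pairwise fun i j => Disjoint (W i) (W j)) :
    unfoldedMass μ (⋃ i ∈ s, W i) = ∑ i ∈ s, unfoldedMass μ (W i) := by
  unfold unfoldedMass
  rw [← lintegral_finsetSum s fun i _ => measurable_cosetCount Γ (hW i)]
  refine lintegral_congr fun q => ?_
  induction q using Quotient.inductionOn with
  | h z =>
    change ∑' γ : Γ, _ = ∑ i ∈ s, ∑' γ : Γ, _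
    rw [← Summable.tsum_finsetSum fun i _ => ENNReal.summable]
    refine tsum_congr fun γ => ?_
    rw [Finset.indicator_biUnion_apply s W fun i _ j _ hij => hd hij]

/-- The measure of a fibre of the orbit map: the orbit of `y` carries the unfolded mass of the
transporter from `α` to `y`, divided by the order of the stabilizer of `y`. -/
lemma measure_preimage_orbitMap {Y : Type*} [MulAction G Y] {α : Y}
    (hα : ∀ y, IsOpen {g : G | g • α = y}) (y : Y) [Finite (MulAction.stabilizer Γ y)] :
    μ (orbitMap Γ α ⁻¹' {Quotient.mk _ y}) = unfoldedMass μ {g | g • α = y} *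
      ((1 / (Nat.card (MulAction.stabilizer Γ y) : ℝ≥0) : ℝ≥0) : ℝ≥0∞) := by
  have h0 : (Nat.card (MulAction.stabilizer Γ y)) ≠ 0 := Nat.card_pos.ne'
  have e : cosetCount Γ {g | g • α = y} = (orbitMap Γ α ⁻¹' {Quotient.mk _ y}).indicator
        (fun _ => (Nat.card (MulAction.stabilizer Γ y) : ℝ≥0∞)) :=
    funext fun q => cosetCount_orbit Γ α y q
  rw [unfoldedMass, e, lintegral_indicator_const (isOpen_preimage_orbitMap Γ hα _).measurableSet,
    one_div, ENNReal.coe_inv (by exact_mod_cast h0), ENNReal.coe_natCast,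
    mul_right_comm, ENNReal.mul_inv_cancel (by exact_mod_cast h0) (ENNReal.natCast_ne_top _),
    one_mul]

end Unfolding

/-! ### The measure of the quotient diagram -/

section Diagram

variable {V : Type*} {X : SimpleGraph V} {G : Subgroup (X ≃g X)} {Γ : Subgroup G}

lemma isOpen_vertex_transporter (a x : V) : IsOpen {g : G | g • a = x} :=
  isOpen_setOf_apply_eq a x

lemma dart_smul_eq_iff (g : G) (d e : X.Dart) :
    g • d = e ↔ g • d.fst = e.fst ∧ g • d.snd = e.snd := by
  rw [SimpleGraph.Dart.ext_iff, Prod.ext_iff]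
  rfl

lemma isOpen_dart_transporter (d e : X.Dart) : IsOpen {g : G | g • d = e} := by
  simp only [dart_smul_eq_iff]
  exact (isOpen_vertex_transporter _ _).inter (isOpen_vertex_transporter _ _)

lemma finite_dart_stabilizer (e : X.Dart) [h : Finite (MulAction.stabilizer Γ e.fst)] :
    Finite (MulAction.stabilizer Γ e) := by
  refine Finite.of_injective (β := MulAction.stabilizer Γ e.fst)
    (fun γ => ⟨γ.1, congrArg (fun e : X.Dart => e.fst) γ.2⟩) ?_
  intro γ γ' h
  exact Subtype.ext (congrArg (fun γ : MulAction.stabilizer Γ e.fst => γ.1) h)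

variable {μ : Measure (RightCosets Γ)}

lemma unfoldedMass_symm (d e : X.Dart) :
    unfoldedMass μ {g : G | g • d.symm = e.symm} = unfoldedMass μ {g : G | g • d = e} := by
  congr 1
  ext g
  simp only [dart_smul_eq_iff, Set.mem_ofPred_eq]
  exact and_comm

/-- The transporter from `a` to `x` splits, according to which neighbour of `a` is mapped to `y`,
into transporters of edges, and local transitivity makes all of these equally large. -/
lemma degree_mul_unfoldedMass [X.LocallyFinite] (hG : IsLocallyTransitive G)
    (hμ : IsInvariantVolume Γ μ) (d e : X.Dart) :
    (X.degree d.fst : ℝ≥0∞) * unfoldedMass μ {g : G | g • d = e} =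
      unfoldedMass μ {g : G | g • d.fst = e.fst} := by
  have h1 : {g : G | g • d.fst = e.fst} =
      ⋃ c ∈ X.neighborFinset d.fst, {g : G | g • d.fst = e.fst ∧ g • c = e.snd} := by
    ext g
    simp only [Set.mem_ofPred_eq, SimpleGraph.mem_neighborFinset, Set.mem_iUnion, exists_prop]
    constructor
    · intro h
      refine ⟨g⁻¹ • e.snd, ?_, h, smul_inv_smul _ _⟩
      have : X.Adj ((g : X ≃g X) d.fst) ((g : X ≃g X) (g⁻¹ • e.snd)) := by
        have h2 : (g : X ≃g X) (g⁻¹ • e.snd) = e.snd := smul_inv_smul g e.snd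
        rw [h2, show (g : X ≃g X) d.fst = e.fst from h]
        exact e.adj
      exact (g : X ≃g X).map_adj_iff.1 this
    · rintro ⟨c, -, h, -⟩
      exact h
  have hop : ∀ c, IsOpen {g : G | g • d.fst = e.fst ∧ g • c = e.snd} := fun c =>
    (isOpen_vertex_transporter _ _).inter (isOpen_vertex_transporter _ _)
  rw [h1, unfoldedMass_biUnion _ _ hop]
  · rw [Finset.sum_congr rfl (g := fun _ => unfoldedMass μ {g : G | g • d = e}),
      Finset.sum_const, SimpleGraph.card_neighborFinset_eq_degree, nsmul_eq_mul]
    intro c hc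
    rw [SimpleGraph.mem_neighborFinset] at hc
    obtain ⟨k, hk, hk1, hk2⟩ := hG _ _ _ hc d.adj
    rw [← unfoldedMass_translate hμ (hop c) ⟨k, hk⟩]
    congr 1
    ext g
    have e1 : (⟨k, hk⟩ : G) • d.fst = d.fst := hk1
    have e2 : (⟨k, hk⟩ : G) • c = d.snd := hk2
    simp only [dart_smul_eq_iff, Set.mem_ofPred_eq]
    rw [mul_smul, mul_smul, e1, e2]
  · intro c c' hcc
    refine Set.disjoint_left.2 fun g h h' => hcc ?_
    exact smul_left_cancel g (h.2.trans h'.2.symm)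

/-- The total unfolded mass of the two transporters from an edge and from its reverse to `e` does
not depend on `e`: it depends only on the origin of `e`, and it is invariant under reversal. -/
lemma unfoldedMass_add_eq [X.LocallyFinite] (hX : X.Connected) (hG : IsLocallyTransitive G)
    (hμ : IsInvariantVolume Γ μ) (d e e' : X.Dart) :
    unfoldedMass μ {g : G | g • d = e} + unfoldedMass μ {g : G | g • d.symm = e} =
      unfoldedMass μ {g : G | g • d = e'} + unfoldedMass μ {g : G | g • d.symm = e'} := by
  have deg0 : ∀ d : X.Dart, (X.degree d.fst : ℝ≥0∞) ≠ 0 := fun d => by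
    exact_mod_cast (X.degree_pos_iff_exists_adj d.fst).2 ⟨_, d.adj⟩ |>.ne'
  have one : ∀ d e e' : X.Dart, e.fst = e'.fst →
      unfoldedMass μ {g : G | g • d = e} = unfoldedMass μ {g : G | g • d = e'} := by
    intro d e e' h
    rw [← ENNReal.mul_right_inj (deg0 d) (ENNReal.natCast_ne_top _),
      degree_mul_unfoldedMass hG hμ d e, degree_mul_unfoldedMass hG hμ d e', h]
  have two : ∀ e e' : X.Dart, e.fst = e'.fst →
      unfoldedMass μ {g : G | g • d = e} + unfoldedMass μ {g : G | g • d.symm = e} =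
      unfoldedMass μ {g : G | g • d = e'} + unfoldedMass μ {g : G | g • d.symm = e'} :=
    fun e e' h => congrArg₂ (· + ·) (one d e e' h) (one d.symm e e' h)
  have three : ∀ e : X.Dart,
      unfoldedMass μ {g : G | g • d = e} + unfoldedMass μ {g : G | g • d.symm = e} =
      unfoldedMass μ {g : G | g • d = e.symm} + unfoldedMass μ {g : G | g • d.symm = e.symm} := by
    intro e
    have h := unfoldedMass_symm (μ := μ) d e.symm
    rw [SimpleGraph.Dart.symm_symm] at h
    rw [unfoldedMass_symm d e, h, add_comm]
  have walk : ∀ {x x' : V} (_ : X.Walk x x') (e : X.Dart), e.fst = x → e'.fst = x' →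
      unfoldedMass μ {g : G | g • d = e} + unfoldedMass μ {g : G | g • d.symm = e} =
      unfoldedMass μ {g : G | g • d = e'} + unfoldedMass μ {g : G | g • d.symm = e'} := by
    intro x x' p
    induction p with
    | nil => exact fun e h h' => two e e' (h.trans h'.symm)
    | @cons x z x' hxz p ih =>
      intro e h h'
      rw [two e ⟨(x, z), hxz⟩ h, three]
      exact ih _ rfl h'
  obtain ⟨p⟩ := hX.preconnected e.fst e'.fst
  exact walk p e rfl rfl

variable (hinv : ActsWithoutInversion Γ)

lemma preimage_orbitMap_boundary (d : X.Dart) (S : Set (QuotientVertex Γ)) :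
    orbitMap Γ d ⁻¹' (quotientDiagram Γ hinv).boundary S =
      {q | orbitMap Γ d.fst q ∈ S ∧ orbitMap Γ d.snd q ∉ S} := by
  ext q
  obtain ⟨z, rfl⟩ := RightCosets.mk_surjective Γ q
  exact Iff.rfl

variable (Γ) in
lemma isOpen_preimage_orbitMap_vertex (a : V) (S : Set (QuotientVertex Γ)) :
    IsOpen (orbitMap Γ a ⁻¹' S) :=
  isOpen_preimage_orbitMap Γ (isOpen_vertex_transporter a) S

/-- Comparison of the volume of `Γ \ G` with the measure of the quotient diagram. For a fixed edge
`d` of `X`, the two maps `Γ z ↦ Γ (z • d.fst)` and `Γ z ↦ Γ (z • d.snd)` together push the volume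
forward to a measure comparable to that of the diagram, and the corresponding maps to edges push it
forward to exactly a multiple of that of the diagram. -/
lemma exists_volume_comparison [X.LocallyFinite] (hX : X.Connected) (hG : IsLocallyTransitive G)
    (hμ : IsInvariantVolume Γ μ) (hfin : ∀ x : V, Finite (MulAction.stabilizer Γ x))
    (d : X.Dart) :
    ∃ C : ℝ≥0, 0 < C ∧
      (∀ S : Set (QuotientVertex Γ), C * (quotientDiagram Γ hinv).vol S ≤
        μ (orbitMap Γ d.fst ⁻¹' S) + μ (orbitMap Γ d.snd ⁻¹' S)) ∧
      (∀ S : Set (QuotientVertex Γ),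
        μ (orbitMap Γ d.fst ⁻¹' S) + μ (orbitMap Γ d.snd ⁻¹' S) ≤
          ((X.degree d.fst + X.degree d.snd : ℕ) : ℝ≥0) *
            (C * (quotientDiagram Γ hinv).vol S)) ∧
      ∀ S : Set (QuotientVertex Γ),
        μ {q | orbitMap Γ d.fst q ∈ S ∧ orbitMap Γ d.snd q ∉ S} +
          μ {q | orbitMap Γ d.snd q ∈ S ∧ orbitMap Γ d.fst q ∉ S} =
        C * (quotientDiagram Γ hinv).edgeVol ((quotientDiagram Γ hinv).boundary S) := by
  set D := quotientDiagram Γ hinv with hD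
  have := hμ.finite
  have := countable_of_connected hX
  have : Countable X.Dart := SimpleGraph.Dart.toProd_injective.countable
  have : Countable (QuotientVertex Γ) := Quotient.mk_surjective.countable
  have : Countable (QuotientEdge Γ) := Quotient.mk_surjective.countable
  have hfinE : ∀ e : X.Dart, Finite (MulAction.stabilizer Γ e) := fun e => finite_dart_stabilizer e
  have fibV : ∀ a x : V, μ (orbitMap Γ a ⁻¹' {Quotient.mk _ x}) =
      unfoldedMass μ {g : G | g • a = x} * (D.μV (Quotient.mk _ x) : ℝ≥0∞) := fun a x =>
    measure_preimage_orbitMap (isOpen_vertex_transporter a) x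
  have fibE : ∀ d e : X.Dart, μ (orbitMap Γ d ⁻¹' {Quotient.mk _ e}) =
      unfoldedMass μ {g : G | g • d = e} * (D.μE (Quotient.mk _ e) : ℝ≥0∞) := fun d e =>
    measure_preimage_orbitMap (isOpen_dart_transporter d) e
  set C : ℝ≥0∞ := unfoldedMass μ {g : G | g • d = d} + unfoldedMass μ {g : G | g • d.symm = d}
    with hC
  have hCe : ∀ e : X.Dart,
      unfoldedMass μ {g : G | g • d = e} + unfoldedMass μ {g : G | g • d.symm = e} = C := fun e =>
    unfoldedMass_add_eq hX hG hμ d e d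
  have posE : ∀ e : X.Dart, (D.μE (Quotient.mk _ e) : ℝ≥0∞) ≠ 0 := by
    intro e
    rw [ENNReal.coe_ne_zero]
    have := hfinE e
    change (1 / (Nat.card (MulAction.stabilizer Γ e) : ℝ≥0)) ≠ 0
    exact one_div_ne_zero (by exact_mod_cast Nat.card_pos.ne')
  have hCtop : C ≠ ∞ := by
    refine ENNReal.add_ne_top.2 ⟨fun h => ?_, fun h => ?_⟩
    · refine measure_ne_top μ (orbitMap Γ d ⁻¹' {Quotient.mk _ d}) ?_
      rw [fibE, h, ENNReal.top_mul (posE d)]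
    · refine measure_ne_top μ (orbitMap Γ d.symm ⁻¹' {Quotient.mk _ d}) ?_
      rw [fibE, h, ENNReal.top_mul (posE d)]
  set p := X.degree d.fst with hp
  set q := X.degree d.snd with hq
  have p1 : 1 ≤ (p : ℝ≥0∞) := by
    exact_mod_cast (X.degree_pos_iff_exists_adj d.fst).2 ⟨_, d.adj⟩
  have q1 : 1 ≤ (q : ℝ≥0∞) := by
    exact_mod_cast (X.degree_pos_iff_exists_adj d.snd).2 ⟨_, d.adj.symm⟩
  have exE : ∀ x : V, ∃ e : X.Dart, e.fst = x := by
    intro x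
    have : Nontrivial V := ⟨_, _, d.adj.ne⟩
    obtain ⟨y, hy⟩ := hX.preconnected.exists_adj_of_nontrivial x
    exact ⟨⟨(x, y), hy⟩, rfl⟩
  have vmass : ∀ x : V, ∃ m m' : ℝ≥0∞, m + m' = C ∧
      unfoldedMass μ {g : G | g • d.fst = x} = p * m ∧
      unfoldedMass μ {g : G | g • d.snd = x} = q * m' := by
    intro x
    obtain ⟨e, rfl⟩ := exE x
    exact ⟨_, _, hCe e, (degree_mul_unfoldedMass hG hμ d e).symm,
      (degree_mul_unfoldedMass hG hμ d.symm e).symm⟩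
  have sumV : ∀ (a : V) (S : Set (QuotientVertex Γ)),
      μ (orbitMap Γ a ⁻¹' S) = ∑' x : S, μ (orbitMap Γ a ⁻¹' {x.1}) := fun a S =>
    (tsum_measure_preimage_singleton S.to_countable fun x _ =>
      (isOpen_preimage_orbitMap_vertex Γ a _).measurableSet).symm
  have sumE : ∀ (d : X.Dart) (S : Set (QuotientEdge Γ)),
      μ (orbitMap Γ d ⁻¹' S) = ∑' e : S, μ (orbitMap Γ d ⁻¹' {e.1}) := fun d S =>
    (tsum_measure_preimage_singleton S.to_countable fun x _ =>
      (isOpen_preimage_orbitMap Γ (isOpen_dart_transporter d) _).measurableSet).symm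
  have lower : ∀ S : Set (QuotientVertex Γ), C * D.vol S ≤
      μ (orbitMap Γ d.fst ⁻¹' S) + μ (orbitMap Γ d.snd ⁻¹' S) := by
    intro S
    rw [sumV, sumV, ← ENNReal.tsum_add, WeightedDiagram.vol, ← ENNReal.tsum_mul_left]
    refine ENNReal.tsum_le_tsum ?_
    rintro ⟨x, hx⟩
    induction x using Quotient.inductionOn with
    | h x =>
      obtain ⟨m, m', hm, h1, h2⟩ := vmass x
      rw [fibV, fibV, h1, h2, ← add_mul, ← hm]
      gcongr
      · exact le_mul_of_one_le_left' p1
      · exact le_mul_of_one_le_left' q1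
  have upper : ∀ S : Set (QuotientVertex Γ),
      μ (orbitMap Γ d.fst ⁻¹' S) + μ (orbitMap Γ d.snd ⁻¹' S) ≤
        ((p + q : ℕ) : ℝ≥0) * (C * D.vol S) := by
    intro S
    rw [sumV, sumV, ← ENNReal.tsum_add, WeightedDiagram.vol, ← ENNReal.tsum_mul_left,
      ← ENNReal.tsum_mul_left]
    refine ENNReal.tsum_le_tsum ?_
    rintro ⟨x, hx⟩
    induction x using Quotient.inductionOn with
    | h x =>
      obtain ⟨m, m', hm, h1, h2⟩ := vmass x
      rw [fibV, fibV, h1, h2, ← add_mul, ← mul_assoc]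
      gcongr
      push_cast
      rw [add_mul]
      gcongr
      · exact hm ▸ le_self_add
      · exact hm ▸ le_add_self
  have hC0 : C ≠ 0 := by
    intro h0
    have := upper Set.univ
    rw [h0, zero_mul, mul_zero, Set.preimage_univ] at this
    exact hμ.ne_zero (Measure.measure_univ_eq_zero.1 (by simpa using this))
  lift C to ℝ≥0 using hCtop with C'
  refine ⟨C', pos_iff_ne_zero.2 (by exact_mod_cast hC0), lower, upper, fun S => ?_⟩
  have b1 := preimage_orbitMap_boundary hinv d S
  have b2 := preimage_orbitMap_boundary hinv d.symm S
  rw [← b1]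
  change _ + μ {q | orbitMap Γ d.symm.fst q ∈ S ∧ orbitMap Γ d.symm.snd q ∉ S} = _
  rw [← b2, sumE, sumE, ← ENNReal.tsum_add, WeightedDiagram.edgeVol, ← ENNReal.tsum_mul_left]
  refine tsum_congr ?_
  rintro ⟨e, he⟩
  induction e using Quotient.inductionOn with
  | h e => rw [fibE, fibE, ← add_mul, hCe e]

lemma isFiniteVolume_quotientDiagram [X.LocallyFinite] (hX : X.Connected)
    (hG : IsLocallyTransitive G) (hμ : IsInvariantVolume Γ μ)
    (hfin : ∀ x : V, Finite (MulAction.stabilizer Γ x)) (d : X.Dart) :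
    (quotientDiagram Γ hinv).IsFiniteVolume := by
  have hfinE : ∀ e : X.Dart, Finite (MulAction.stabilizer Γ e) := fun e => finite_dart_stabilizer e
  have hle : ∀ e : X.Dart, MulAction.stabilizer Γ e ≤ MulAction.stabilizer Γ e.fst :=
    fun e γ hγ => congrArg (fun e : X.Dart => e.fst) hγ
  have hcard : ∀ e : X.Dart, Nat.card (MulAction.stabilizer Γ e) *
      (MulAction.stabilizer Γ e).relIndex (MulAction.stabilizer Γ e.fst) =
      Nat.card (MulAction.stabilizer Γ e.fst) := by
    intro e
    rw [← Subgroup.relIndex_bot_left, ← Subgroup.relIndex_bot_left]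
    exact Subgroup.relIndex_mul_relIndex _ _ _ bot_le (hle e)
  have posV : ∀ x : V, (Nat.card (MulAction.stabilizer Γ x) : ℝ≥0) ≠ 0 := fun x => by
    have := hfin x
    exact_mod_cast Nat.card_pos.ne'
  have posE : ∀ e : X.Dart, (Nat.card (MulAction.stabilizer Γ e) : ℝ≥0) ≠ 0 := fun x => by
    have := hfinE x
    exact_mod_cast Nat.card_pos.ne'
  have hcard' : ∀ e : X.Dart, (Nat.card (MulAction.stabilizer Γ e) : ℝ≥0) *
      ((MulAction.stabilizer Γ e).relIndex (MulAction.stabilizer Γ e.fst) : ℕ) =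
      (Nat.card (MulAction.stabilizer Γ e.fst) : ℝ≥0) := fun e => by exact_mod_cast hcard e
  refine ⟨?_, ?_, ?_, ?_, ?_, ?_⟩
  · intro e
    induction e using Quotient.inductionOn with
    | h e => exact pos_iff_ne_zero.2 (right_ne_zero_of_mul ((hcard' e).trans_ne (posV e.fst)))
  · intro x
    induction x using Quotient.inductionOn with
    | h x => exact pos_iff_ne_zero.2 (one_div_ne_zero (posV x))
  · intro e
    induction e using Quotient.inductionOn with
    | h e => exact pos_iff_ne_zero.2 (one_div_ne_zero (posE e))
  · intro e
    induction e using Quotient.inductionOn with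
    | h e =>
      change ((MulAction.stabilizer Γ e).relIndex (MulAction.stabilizer Γ e.fst) : ℝ≥0) *
        (1 / (Nat.card (MulAction.stabilizer Γ e.fst) : ℝ≥0)) =
        1 / (Nat.card (MulAction.stabilizer Γ e) : ℝ≥0)
      rw [mul_one_div, div_eq_div_iff (posV _) (posE _), one_mul, mul_comm]
      exact hcard' e
  · intro e
    induction e using Quotient.inductionOn with
    | h e =>
      have : MulAction.stabilizer Γ e.symm = MulAction.stabilizer Γ e := by
        ext γ
        rw [MulAction.mem_stabilizer_iff, MulAction.mem_stabilizer_iff, ← smul_dart_symm]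
        exact SimpleGraph.Dart.symm_involutive.injective.eq_iff
      change 1 / (Nat.card (MulAction.stabilizer Γ e) : ℝ≥0) =
        1 / (Nat.card (MulAction.stabilizer Γ e.symm) : ℝ≥0)
      rw [this]
  · obtain ⟨C, hC, hlow, -, -⟩ := exists_volume_comparison hinv hX hG hμ hfin d
    have := hμ.finite
    have h1 := hlow Set.univ
    rw [WeightedDiagram.vol, tsum_univ fun x => ((quotientDiagram Γ hinv).μV x : ℝ≥0∞)] at h1
    rw [← ENNReal.tsum_coe_ne_top_iff_summable]
    intro h2
    rw [h2, ENNReal.mul_top (by exact_mod_cast hC.ne')] at h1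
    exact (ENNReal.add_lt_top.2 ⟨measure_lt_top _ _, measure_lt_top _ _⟩).not_ge h1

end Diagram

/-! ### Small boundaries give almost invariant vectors -/

section AlmostInvariant

lemma enorm_sq_eq_lintegral {Ω : Type*} [MeasurableSpace Ω] {μ : Measure Ω} (f : Lp ℂ 2 μ) :
    ‖f‖ₑ ^ 2 = ∫⁻ x, ‖f x‖ₑ ^ 2 ∂μ := by
  have h := eLpNorm_nnreal_pow_eq_lintegral (f := f) (p := 2) (μ := μ) two_ne_zero
  simp only [NNReal.coe_ofNat, ENNReal.rpow_ofNat] at h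
  rw [Lp.enorm_def, ← h]
  rfl

lemma enorm_sq_of_ae {Ω : Type*} [MeasurableSpace Ω] {μ : Measure Ω} {f : Lp ℂ 2 μ} {φ : Ω → ℂ}
    (h : f =ᵐ[μ] φ) : ‖f‖ₑ ^ 2 = ∫⁻ x, ‖φ x‖ₑ ^ 2 ∂μ := by
  rw [enorm_sq_eq_lintegral]
  exact lintegral_congr_ae (h.fun_comp fun z => ‖z‖ₑ ^ 2)

lemma norm_sq_eq_integral {Ω : Type*} [MeasurableSpace Ω] {μ : Measure Ω} (f : Lp ℂ 2 μ) :
    ‖f‖ ^ 2 = ∫ x, ‖f x‖ ^ 2 ∂μ := by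
  rw [integral_eq_lintegral_of_nonneg_ae (Filter.Eventually.of_forall fun x => sq_nonneg _)
    ((Lp.aestronglyMeasurable f).norm.pow 2)]
  have : ∀ x, ENNReal.ofReal (‖f x‖ ^ 2) = ‖f x‖ₑ ^ 2 := fun x => by
    rw [ENNReal.ofReal_pow (norm_nonneg _), ofReal_norm]
  simp only [this]
  rw [← enorm_sq_eq_lintegral, ENNReal.toReal_pow, toReal_enorm]

lemma norm_sq_of_ae {Ω : Type*} [MeasurableSpace Ω] {μ : Measure Ω} {f : Lp ℂ 2 μ} {φ : Ω → ℂ}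
    (h : f =ᵐ[μ] φ) : ‖f‖ ^ 2 = ∫ x, ‖φ x‖ ^ 2 ∂μ := by
  rw [norm_sq_eq_integral]
  exact integral_congr_ae (h.fun_comp fun z => ‖z‖ ^ 2)

section Centered

variable {G : Type*} [Group G] [TopologicalSpace G] [IsTopologicalGroup G] {Γ : Subgroup G}
  {μ : Measure (RightCosets Γ)}

/-- The vector `ξ` is the indicator function of `A` minus its mean. -/
lemma exists_centered_indicator (hμ : IsInvariantVolume Γ μ) {A : Set (RightCosets Γ)}
    (hA : MeasurableSet A) :
    ∃ ξ : L2Zero hμ, μ.real Set.univ * ‖ξ‖ ^ 2 = μ.real A * μ.real Aᶜ ∧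
      ∀ g : G, ‖rightRegularZero hμ g ξ - ξ‖ ^ 2 =
        μ.real (symmDiff (RightCosets.translate Γ g ⁻¹' A) A) := by
  classical
  have := hμ.finite
  have hT : 0 < μ.real Set.univ := by
    have : NeZero μ := ⟨hμ.ne_zero⟩
    exact measureReal_univ_pos
  set T := μ.real Set.univ
  set t : ℝ := μ.real A / T with ht
  have hAc : μ.real Aᶜ = T - μ.real A := measureReal_compl hA
  let φ : RightCosets Γ → ℂ := fun q => A.indicator (fun _ => (1 : ℂ)) q - (t : ℂ)
  have hφ : MemLp φ 2 μ := by
    refine MemLp.sub ?_ (memLp_const _)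
    exact (memLp_const (1 : ℂ)).indicator hA
  have hae : (hφ.toLp φ : RightCosets Γ → ℂ) =ᵐ[μ] φ := hφ.coeFn_toLp
  have h0 : hφ.toLp φ ∈ L2Zero hμ := by
    change ∫ q, hφ.toLp φ q ∂μ = 0
    rw [integral_congr_ae hae, integral_sub ((integrable_const _).indicator hA)
      (integrable_const _), integral_indicator_const _ hA, integral_const]
    simp only [ht, Complex.real_smul]
    change ((μ.real A : ℝ) : ℂ) * 1 - (T : ℂ) * ((μ.real A / T : ℝ) : ℂ) = 0
    rw [mul_one, ← Complex.ofReal_mul, mul_div_cancel₀ _ hT.ne', sub_self]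
  refine ⟨⟨hφ.toLp φ, h0⟩, ?_, fun g => ?_⟩
  · change T * ‖hφ.toLp φ‖ ^ 2 = _
    have e : ∀ q, ‖φ q‖ ^ 2 = A.indicator (fun _ => (1 - t) ^ 2) q +
        Aᶜ.indicator (fun _ => t ^ 2) q := by
      intro q
      by_cases hq : q ∈ A
      · have : φ q = ((1 - t : ℝ) : ℂ) := by simp [φ, hq]
        rw [this, Complex.norm_real]
        simp [hq]
      · have : φ q = ((-t : ℝ) : ℂ) := by simp [φ, hq]
        rw [this, Complex.norm_real]
        simp [hq]
    rw [norm_sq_of_ae hae]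
    simp only [e]
    rw [integral_add ((integrable_const _).indicator hA)
      ((integrable_const _).indicator hA.compl), integral_indicator_const _ hA,
      integral_indicator_const _ hA.compl, hAc, ht]
    simp only [smul_eq_mul]
    field_simp
    ring
  · change ‖rightRegular hμ g (hφ.toLp φ) - hφ.toLp φ‖ ^ 2 = _
    have h1 : (rightRegular hμ g (hφ.toLp φ) - hφ.toLp φ : Lp ℂ 2 μ) =ᵐ[μ]
        fun q => φ (RightCosets.translate Γ g q) - φ q := by
      refine (Lp.coeFn_sub _ _).trans (Filter.EventuallyEq.sub ?_ hae)
      exact (rightRegular_coeFn hμ g _).trans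
        ((hμ.measurePreserving g).quasiMeasurePreserving.ae_eq_comp hae)
    have e : ∀ q, ‖φ (RightCosets.translate Γ g q) - φ q‖ ^ 2 =
        (symmDiff (RightCosets.translate Γ g ⁻¹' A) A).indicator (fun _ => (1 : ℝ)) q := by
      intro q
      simp only [φ, sub_sub_sub_cancel_right, Set.indicator_apply, Set.mem_symmDiff,
        Set.mem_preimage]
      by_cases h1 : RightCosets.translate Γ g q ∈ A <;> by_cases h2 : q ∈ A <;> simp [h1, h2]
    rw [norm_sq_of_ae h1]
    simp only [e]
    rw [integral_indicator_const _ (((hμ.measurePreserving g).measurable hA).symmDiff hA)]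
    simp

end Centered

variable {V : Type*} {X : SimpleGraph V} {G : Subgroup (X ≃g X)} {Γ : Subgroup G}
  {μ : Measure (RightCosets Γ)}

lemma preimage_translate_orbitMap (a : V) (g : G) (S : Set (QuotientVertex Γ)) :
    RightCosets.translate Γ g ⁻¹' (orbitMap Γ a ⁻¹' S) = orbitMap Γ (g • a) ⁻¹' S := by
  ext q
  rw [Set.mem_preimage, Set.mem_preimage, orbitMap_translate]
  rfl

/-- The sets `{q | orbitMap Γ x q ∈ S}` for different vertices `x` differ in measure by at most the
distance of the vertices times the measure of the boundary of `S`. -/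
lemma measure_symmDiff_orbitMap_le (hX : X.Connected) (hG : IsLocallyTransitive G)
    (hμ : IsInvariantVolume Γ μ) (d : X.Dart) (S : Set (QuotientVertex Γ)) {x y : V}
    (p : X.Walk x y) :
    μ (symmDiff (orbitMap Γ x ⁻¹' S) (orbitMap Γ y ⁻¹' S)) ≤
      p.length * μ (symmDiff (orbitMap Γ d.fst ⁻¹' S) (orbitMap Γ d.snd ⁻¹' S)) := by
  induction p with
  | nil => simp
  | @cons x z y hxz p ih =>
    have h1 : μ (symmDiff (orbitMap Γ x ⁻¹' S) (orbitMap Γ z ⁻¹' S)) =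
        μ (symmDiff (orbitMap Γ d.fst ⁻¹' S) (orbitMap Γ d.snd ⁻¹' S)) := by
      have key : ∀ g : G, μ (symmDiff (orbitMap Γ (g • d.fst) ⁻¹' S)
          (orbitMap Γ (g • d.snd) ⁻¹' S)) =
          μ (symmDiff (orbitMap Γ d.fst ⁻¹' S) (orbitMap Γ d.snd ⁻¹' S)) := by
        intro g
        rw [← preimage_translate_orbitMap, ← preimage_translate_orbitMap,
          ← Set.preimage_symmDiff]
        refine (hμ.measurePreserving g).measure_preimage (MeasurableSet.nullMeasurableSet ?_)
        exact (isOpen_preimage_orbitMap_vertex Γ _ S).measurableSet.symmDiff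
          (isOpen_preimage_orbitMap_vertex Γ _ S).measurableSet
      obtain ⟨g, ⟨rfl, rfl⟩ | ⟨rfl, rfl⟩⟩ := hG.exists_edge hX d.adj hxz
      · exact key g
      · rw [symmDiff_comm]
        exact key g
    calc μ (symmDiff (orbitMap Γ x ⁻¹' S) (orbitMap Γ y ⁻¹' S))
        ≤ μ (symmDiff (orbitMap Γ x ⁻¹' S) (orbitMap Γ z ⁻¹' S) ∪
            symmDiff (orbitMap Γ z ⁻¹' S) (orbitMap Γ y ⁻¹' S)) :=
          measure_mono (symmDiff_triangle _ _ _)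
      _ ≤ _ := measure_union_le _ _
      _ ≤ _ := by
          rw [h1, SimpleGraph.Walk.length_cons, Nat.cast_add, Nat.cast_one, add_mul, one_mul,
            add_comm]
          gcongr

lemma WeightedDiagram.vol_add_vol_compl {W E : Type*} (D : WeightedDiagram W E) (S : Set W) :
    D.vol S + D.vol Sᶜ = D.vol Set.univ := by
  unfold WeightedDiagram.vol
  rw [tsum_univ fun x => (D.μV x : ℝ≥0∞), tsum_subtype S fun x => (D.μV x : ℝ≥0∞),
    tsum_subtype Sᶜ fun x => (D.μV x : ℝ≥0∞), ← ENNReal.tsum_add]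
  exact tsum_congr fun x => Set.indicator_self_add_compl_apply S _ x

lemma WeightedDiagram.IsFiniteVolume.vol_ne_top {W E : Type*} {D : WeightedDiagram W E}
    (hD : D.IsFiniteVolume) (S : Set W) : D.vol S ≠ ∞ := by
  have h : D.vol Set.univ ≠ ∞ := by
    unfold WeightedDiagram.vol
    rw [tsum_univ fun x => (D.μV x : ℝ≥0∞)]
    exact ENNReal.tsum_coe_ne_top_iff_summable.2 hD.summable
  exact ne_top_of_le_ne_top h (D.vol_add_vol_compl S ▸ le_self_add)

lemma WeightedDiagram.IsFiniteVolume.vol_ne_zero {W E : Type*} {D : WeightedDiagram W E}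
    (hD : D.IsFiniteVolume) {S : Set W} (hS : S.Nonempty) : D.vol S ≠ 0 := by
  obtain ⟨x, hx⟩ := hS
  intro h
  have := ENNReal.tsum_eq_zero.1 h ⟨x, hx⟩
  exact (hD.μV_pos x).ne' (by exact_mod_cast this)

variable (hinv : ActsWithoutInversion Γ)

set_option maxHeartbeats 1000000 in
/-- If `S` has relatively small boundary and at most half of the total volume, then the centered
indicator function of the inverse image `A` of `S` in `Γ \ G` is almost invariant. Both `A` and its
complement are not too small: the inverse images of `S` for the two end points of an edge have
total measure at least `C vol S`, and differ by at most the measure of the boundary. -/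
lemma hasAlmostInvariantVectors_of_not_isExpander [X.LocallyFinite] (hX : X.Connected)
    (hG : IsLocallyTransitive G) (hμ : IsInvariantVolume Γ μ)
    (hfin : ∀ x : V, Finite (MulAction.stabilizer Γ x)) (d : X.Dart)
    (hexp : ¬ (quotientDiagram Γ hinv).IsExpander) :
    HasAlmostInvariantVectors (rightRegularZero hμ) := by
  intro Q hQ ε hε
  have := hμ.finite
  obtain ⟨C, hC, hlow, -, hbd⟩ := exists_volume_comparison hinv hX hG hμ hfin d
  have hD := isFiniteVolume_quotientDiagram hinv hX hG hμ hfin d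
  set D := quotientDiagram Γ hinv with hDdef
  have hC' : (0 : ℝ) < C := hC
  have hT : 0 < μ.real Set.univ := by
    have : NeZero μ := ⟨hμ.ne_zero⟩
    exact measureReal_univ_pos
  set T := μ.real Set.univ with hTdef
  obtain ⟨R, hR⟩ : ∃ R : ℕ, ∀ g ∈ Q, X.dist d.fst (g • d.fst) ≤ R := by
    obtain ⟨R, hR⟩ := ((finite_image_of_isCompact hQ d.fst).image (X.dist d.fst)).bddAbove
    exact ⟨R, fun g hg => hR ⟨_, ⟨g, hg, rfl⟩, rfl⟩⟩
  set M := (D.vol Set.univ).toReal with hM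
  have hM0 : 0 < M :=
    ENNReal.toReal_pos (hD.vol_ne_zero ⟨Quotient.mk _ d.fst, trivial⟩) (hD.vol_ne_top _)
  obtain ⟨η, hη0, hη1, hη2⟩ : ∃ η : ℝ, 0 < η ∧ η ≤ 1 / 2 ∧
      32 * R * T * η ≤ C * M * (ε / 2) ^ 2 := by
    have hK : 0 < C * M * (ε / 2) ^ 2 := by positivity
    have hL : 0 < 32 * R * T + 1 := by positivity
    refine ⟨min (1 / 2) (C * M * (ε / 2) ^ 2 / (32 * R * T + 1)), by positivity,
      min_le_left _ _, ?_⟩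
    calc 32 * R * T * min (1 / 2) (C * M * (ε / 2) ^ 2 / (32 * R * T + 1))
        ≤ (32 * R * T + 1) * (C * M * (ε / 2) ^ 2 / (32 * R * T + 1)) := by
          gcongr
          · linarith
          · exact min_le_right _ _
      _ = _ := mul_div_cancel₀ _ hL.ne'
  unfold WeightedDiagram.IsExpander at hexp
  push Not at hexp
  lift η to ℝ≥0 using hη0.le
  obtain ⟨S, hSne, hShalf, hS⟩ := hexp η (by exact_mod_cast hη0)
  rw [ENNReal.div_lt_iff (Or.inl (hD.vol_ne_zero hSne)) (Or.inl (hD.vol_ne_top _))] at hS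
  -- real-valued versions of the volume estimates
  set s := (D.vol S).toReal with hs
  have hs0 : 0 < s := ENNReal.toReal_pos (hD.vol_ne_zero hSne) (hD.vol_ne_top _)
  have hsc : (D.vol Sᶜ).toReal = M - s := by
    rw [hM, ← D.vol_add_vol_compl S, ENNReal.toReal_add (hD.vol_ne_top _) (hD.vol_ne_top _)]
    ring
  have hsM : s ≤ M / 2 := by
    have := ENNReal.toReal_mono (ENNReal.div_ne_top (hD.vol_ne_top _) two_ne_zero) hShalf
    rwa [ENNReal.toReal_div] at this
  set A := orbitMap Γ d.fst ⁻¹' S with hA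
  set B := orbitMap Γ d.snd ⁻¹' S with hB
  have mA : MeasurableSet A := (isOpen_preimage_orbitMap_vertex Γ d.fst S).measurableSet
  have mB : MeasurableSet B := (isOpen_preimage_orbitMap_vertex Γ d.snd S).measurableSet
  have hAB : μ.real (symmDiff A B) ≤ C * (η * s) := by
    have h1 : μ (symmDiff A B) ≤ C * (η * D.vol S) :=
      calc μ (symmDiff A B) ≤ μ (A \ B) + μ (B \ A) := measure_union_le _ _
        _ = C * D.edgeVol (D.boundary S) := hbd S
        _ ≤ _ := by gcongr
    have h2 := ENNReal.toReal_mono (ENNReal.mul_ne_top ENNReal.coe_ne_top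
      (ENNReal.mul_ne_top ENNReal.coe_ne_top (hD.vol_ne_top S))) h1
    rw [ENNReal.toReal_mul, ENNReal.toReal_mul, ENNReal.coe_toReal, ENNReal.coe_toReal] at h2
    exact h2
  have hlow' : ∀ S : Set (QuotientVertex Γ), C * (D.vol S).toReal ≤
      μ.real (orbitMap Γ d.fst ⁻¹' S) + μ.real (orbitMap Γ d.snd ⁻¹' S) := by
    intro S
    have := ENNReal.toReal_mono (by finiteness) (hlow S)
    rwa [ENNReal.toReal_mul, ENNReal.toReal_add (by finiteness) (by finiteness)] at this
  have hl1 : C * s ≤ μ.real A + μ.real B := hlow' S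
  have hl2 : C * (M - s) ≤ μ.real Aᶜ + μ.real Bᶜ := hsc ▸ hlow' Sᶜ
  have hBA : μ.real B ≤ μ.real A + μ.real (symmDiff A B) :=
    (measureReal_mono fun q hq => by
      by_cases h : q ∈ A
      · exact Or.inl h
      · exact Or.inr (Or.inr ⟨hq, h⟩)).trans (measureReal_union_le _ _)
  have hBA' : μ.real Bᶜ ≤ μ.real Aᶜ + μ.real (symmDiff A B) :=
    (measureReal_mono fun q hq => by
      by_cases h : q ∈ A
      · exact Or.inr (Or.inl ⟨h, hq⟩)
      · exact Or.inl h).trans (measureReal_union_le _ _)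
  have hAlow : C * s / 4 ≤ μ.real A := by
    have : C * (η * s) ≤ C * (1 / 2 * s) := by gcongr
    linarith
  have hAclow : C * M / 8 ≤ μ.real Aᶜ := by
    have h1 : C * (η * s) ≤ C * (1 / 2 * (M / 2)) := by gcongr
    have h2 : C * (M / 2) ≤ C * (M - s) := by gcongr; linarith
    linarith
  obtain ⟨ξ, hξ, hξg⟩ := exists_centered_indicator hμ mA
  have hprod : C * s / 4 * (C * M / 8) ≤ T * ‖ξ‖ ^ 2 := by
    rw [hξ]
    gcongr
  have hξ0 : 0 < ‖ξ‖ := by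
    have : 0 < T * ‖ξ‖ ^ 2 := lt_of_lt_of_le (by positivity) hprod
    by_contra! h
    have h0 : ‖ξ‖ = 0 := le_antisymm h (norm_nonneg _)
    simp [h0] at this
  refine ⟨((‖ξ‖⁻¹ : ℝ) : ℂ) • ξ, ?_, ε / 2, by linarith, fun g hg => ?_⟩
  · rw [norm_smul, Complex.norm_real, norm_inv, norm_norm, inv_mul_cancel₀ hξ0.ne']
  · rw [map_smul, ← smul_sub, norm_smul, Complex.norm_real, norm_inv, norm_norm,
      inv_mul_le_iff₀ hξ0, mul_comm]
    refine abs_le_of_sq_le_sq' ?_ (by positivity) |>.2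
    obtain ⟨p, hp⟩ := hX.exists_walk_length_eq_dist d.fst (g • d.fst)
    have h1 : μ.real (symmDiff A (orbitMap Γ (g • d.fst) ⁻¹' S)) ≤
        R * (C * (η * s)) := by
      have h := ENNReal.toReal_mono (by finiteness)
        (measure_symmDiff_orbitMap_le hX hG hμ d S p)
      rw [ENNReal.toReal_mul, ENNReal.toReal_natCast] at h
      refine h.trans ?_
      gcongr
      · rw [hp]; exact_mod_cast hR g hg
      · exact hAB
    rw [hξg g, preimage_translate_orbitMap, symmDiff_comm]
    refine h1.trans ?_
    rw [mul_pow]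
    have h2 : T * (R * (C * (η * s))) ≤ T * ((ε / 2) ^ 2 * ‖ξ‖ ^ 2) := by
      calc T * (R * (C * (η * s))) = C * s / 32 * (32 * R * T * η) := by ring
        _ ≤ C * s / 32 * (C * M * (ε / 2) ^ 2) := by gcongr
        _ = (ε / 2) ^ 2 * (C * s / 4 * (C * M / 8)) := by ring
        _ ≤ (ε / 2) ^ 2 * (T * ‖ξ‖ ^ 2) := by gcongr
        _ = _ := by ring
    exact le_of_mul_le_mul_left h2 hT

end AlmostInvariant

/-! ### Averaging over a compact open subgroup -/

section Averaging

variable {G : Type*} [Group G] [TopologicalSpace G] [IsTopologicalGroup G] {Γ : Subgroup G}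
  {μ : Measure (RightCosets Γ)}

variable (Γ) in
lemma RightCosets.isOpenQuotientMap_mk : IsOpenQuotientMap (RightCosets.mk Γ) := by
  refine ⟨RightCosets.mk_surjective Γ, continuous_quotient_mk', fun U hU => ?_⟩
  change IsOpen (RightCosets.mk Γ ⁻¹' (RightCosets.mk Γ '' U))
  have : RightCosets.mk Γ ⁻¹' (RightCosets.mk Γ '' U) = ⋃ γ : Γ, (fun z => (γ : G) * z) ⁻¹' U := by
    ext z
    simp only [Set.mem_preimage, Set.mem_image, Set.mem_iUnion]
    constructor
    · rintro ⟨w, hw, h⟩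
      have h : QuotientGroup.rightRel Γ z w := Quotient.exact h.symm
      rw [QuotientGroup.rightRel_apply] at h
      exact ⟨⟨_, h⟩, by simpa using hw⟩
    · rintro ⟨γ, hγ⟩
      refine ⟨_, hγ, Quotient.sound ?_⟩
      change QuotientGroup.rightRel Γ _ _
      rw [QuotientGroup.rightRel_apply]
      simp
  rw [this]
  exact isOpen_iUnion fun γ => hU.preimage (continuous_const_mul (γ : G))

variable (Γ) in
lemma RightCosets.continuous_translate_uncurry :
    Continuous fun p : RightCosets Γ × G => RightCosets.translate Γ p.2 p.1 := by
  have h := ((RightCosets.isOpenQuotientMap_mk Γ).prodMap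
    (IsOpenQuotientMap.id (X := G))).isQuotientMap
  rw [h.continuous_iff]
  exact (RightCosets.isOpenQuotientMap_mk Γ).continuous.comp continuous_mul

lemma enorm_integral_sub_sq_le {K : Type*} [MeasurableSpace K] (ν : Measure K)
    [IsProbabilityMeasure ν] {f : K → ℂ} (hf : AEStronglyMeasurable f ν) (c : ℂ) :
    ‖(∫ k, f k ∂ν) - c‖ₑ ^ 2 ≤ ∫⁻ k, ‖f k - c‖ₑ ^ 2 ∂ν := by
  rcases eq_or_ne (∫⁻ k, ‖f k - c‖ₑ ^ 2 ∂ν) ∞ with h | h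
  · rw [h]
    exact le_top
  have hm : AEStronglyMeasurable (fun k => f k - c) ν := hf.sub aestronglyMeasurable_const
  have h2 : eLpNorm (fun k => f k - c) 2 ν ^ 2 = ∫⁻ k, ‖f k - c‖ₑ ^ 2 ∂ν := by
    have h := eLpNorm_nnreal_pow_eq_lintegral (f := fun k => f k - c) (p := 2) (μ := ν) two_ne_zero
    simp only [NNReal.coe_ofNat, ENNReal.rpow_ofNat] at h
    exact h
  have hL : MemLp (fun k => f k - c) 2 ν := by
    refine ⟨hm, lt_top_iff_ne_top.2 fun h0 => h ?_⟩
    rw [← h2, h0]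
    rfl
  have hi : Integrable (fun k => f k - c) ν := hL.integrable one_le_two
  have hi' : Integrable f ν := (hi.add (integrable_const c)).congr
    (Filter.Eventually.of_forall fun k => sub_add_cancel (f k) c)
  have e : (∫ k, f k ∂ν) - c = ∫ k, (f k - c) ∂ν := by
    rw [integral_sub hi' (integrable_const c)]
    simp
  rw [e, ← h2]
  gcongr
  refine (enorm_integral_le_lintegral_enorm _).trans ?_
  rw [← eLpNorm_one_eq_lintegral_enorm]
  exact eLpNorm_le_eLpNorm_of_exponent_le one_le_two hm

/-- A vector which is moved by at most `δ` by the stabilizer of `α`, assumed compact, is at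
distance at most `δ` from a function that factors through the orbit map of `α`, namely its average
over the stabilizer. -/
lemma exists_average {Y : Type*} [MulAction G Y] [SecondCountableTopology G]
    (hμ : IsInvariantVolume Γ μ) {α : Y} (hα : ∀ y, IsOpen {g : G | g • α = y})
    (hK : IsCompact {g : G | g • α = α}) (ξ : Lp ℂ 2 μ) {δ : ℝ}
    (hξ : ∀ g : G, g • α = α → ‖rightRegular hμ g ξ - ξ‖ ≤ δ) :
    ∃ (F : MulAction.orbitRel.Quotient Γ Y → ℂ) (U : Lp ℂ 2 μ),
      U =ᵐ[μ] (fun q => F (orbitMap Γ α q)) ∧ ‖U - ξ‖ ≤ δ := by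
  have := hμ.finite
  have hδ : 0 ≤ δ := (norm_nonneg _).trans (hξ 1 (one_smul _ _))
  let K : Subgroup G := MulAction.stabilizer G α
  have : CompactSpace K := isCompact_iff_compactSpace.1 hK
  let _ : MeasurableSpace K := borel K
  have : BorelSpace K := ⟨rfl⟩
  have : SecondCountableTopology K :=
    TopologicalSpace.Subtype.secondCountableTopology (K : Set G)
  let ν : Measure K := Measure.haarMeasure ⊤
  have : IsProbabilityMeasure ν := ⟨Measure.haarMeasure_self⟩
  have hcont : Continuous fun p : RightCosets Γ × K => RightCosets.translate Γ (p.2 : G) p.1 :=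
    (RightCosets.continuous_translate_uncurry Γ).comp
      (continuous_fst.prodMk (continuous_subtype_val.comp continuous_snd))
  have hsm : StronglyMeasurable (ξ : RightCosets Γ → ℂ) := Lp.stronglyMeasurable ξ
  let avg : RightCosets Γ → ℂ := fun q => ∫ k : K, ξ (RightCosets.translate Γ (k : G) q) ∂ν
  -- by left invariance of the Haar measure
  have havg : avg.FactorsThrough (orbitMap Γ α) := by
    intro q q' h
    obtain ⟨z, rfl⟩ := RightCosets.mk_surjective Γ q
    obtain ⟨w, rfl⟩ := RightCosets.mk_surjective Γ q'
    obtain ⟨γ, hγ⟩ := Quotient.exact h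
    have hγ : ((γ : G) * w) • α = z • α := by
      rw [mul_smul]
      exact hγ
    let k₀ : K := ⟨z⁻¹ * (γ * w), by
      rw [MulAction.mem_stabilizer_iff, mul_smul, hγ, inv_smul_smul]⟩
    have e : RightCosets.mk Γ w = RightCosets.mk Γ (z * k₀) := by
      refine Quotient.sound ?_
      change QuotientGroup.rightRel Γ _ _
      rw [QuotientGroup.rightRel_apply]
      simp [k₀]
    change ∫ k : K, ξ (RightCosets.mk Γ (z * k)) ∂ν =
      ∫ k : K, ξ (RightCosets.translate Γ k (RightCosets.mk Γ w)) ∂ν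
    rw [e]
    refine (integral_mul_left_eq_self (fun k : K => ξ (RightCosets.mk Γ (z * k))) k₀).symm.trans ?_
    refine integral_congr_ae (Filter.Eventually.of_forall fun k => ?_)
    simp only [RightCosets.translate_mk, Subgroup.coe_mul, mul_assoc]
  let F : MulAction.orbitRel.Quotient Γ Y → ℂ := Function.extend (orbitMap Γ α) avg 0
  have hF : ∀ q, F (orbitMap Γ α q) = avg q := fun q => havg.extend_apply 0 q
  have hFm : Measurable fun q => F (orbitMap Γ α q) := fun s _ =>
    (isOpen_preimage_orbitMap Γ hα (F ⁻¹' s)).measurableSet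
  have hmain : ∫⁻ q, ‖F (orbitMap Γ α q) - ξ q‖ₑ ^ 2 ∂μ ≤ ENNReal.ofReal δ ^ 2 := by
    calc ∫⁻ q, ‖F (orbitMap Γ α q) - ξ q‖ₑ ^ 2 ∂μ
        ≤ ∫⁻ q, ∫⁻ k : K, ‖ξ (RightCosets.translate Γ (k : G) q) - ξ q‖ₑ ^ 2 ∂ν ∂μ := by
          refine lintegral_mono fun q => ?_
          rw [hF]
          refine enorm_integral_sub_sq_le ν ?_ (ξ q)
          exact (hsm.comp_measurable
            (hcont.comp (Continuous.prodMk_right q)).measurable).aestronglyMeasurable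
      _ = ∫⁻ k : K, ∫⁻ q, ‖ξ (RightCosets.translate Γ (k : G) q) - ξ q‖ₑ ^ 2 ∂μ ∂ν := by
          refine lintegral_lintegral_swap (Measurable.aemeasurable ?_)
          exact ((hsm.measurable.comp hcont.measurable).sub
            (hsm.measurable.comp measurable_fst)).enorm.pow_const 2
      _ ≤ ∫⁻ _ : K, ENNReal.ofReal δ ^ 2 ∂ν := by
          refine lintegral_mono fun k => ?_
          have h1 : (rightRegular hμ (k : G) ξ - ξ : Lp ℂ 2 μ) =ᵐ[μ]
              fun q => ξ (RightCosets.translate Γ (k : G) q) - ξ q :=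
            (Lp.coeFn_sub _ _).trans ((rightRegular_coeFn hμ k ξ).sub (ae_eq_refl _))
          refine (enorm_sq_of_ae h1).symm.trans_le ?_
          gcongr
          rw [← ofReal_norm]
          exact ENNReal.ofReal_le_ofReal (hξ k k.2)
      _ = _ := by simp
  have hdiff : MemLp (fun q => F (orbitMap Γ α q) - ξ q) 2 μ := by
    refine ⟨(hFm.sub hsm.measurable).aestronglyMeasurable, lt_top_iff_ne_top.2 fun h0 => ?_⟩
    have h := eLpNorm_nnreal_pow_eq_lintegral (f := fun q => F (orbitMap Γ α q) - ξ q) (p := 2)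
      (μ := μ) two_ne_zero
    simp only [NNReal.coe_ofNat, ENNReal.rpow_ofNat] at h
    rw [← h] at hmain
    change eLpNorm (fun q => F (orbitMap Γ α q) - ξ q) 2 μ ^ 2 ≤ _ at hmain
    rw [h0] at hmain
    exact absurd hmain (by simp)
  have hU : MemLp (fun q => F (orbitMap Γ α q)) 2 μ := by
    exact (memLp_congr_ae (Filter.Eventually.of_forall fun q => sub_add_cancel _ (ξ q))).1
      (hdiff.add (Lp.memLp ξ))
  refine ⟨F, hU.toLp _, hU.coeFn_toLp, ?_⟩
  have h3 : (hU.toLp _ - ξ : Lp ℂ 2 μ) =ᵐ[μ] fun q => F (orbitMap Γ α q) - ξ q :=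
    (Lp.coeFn_sub _ _).trans (hU.coeFn_toLp.sub (ae_eq_refl _))
  have h5 : ‖(hU.toLp _ - ξ : Lp ℂ 2 μ)‖ₑ ≤ ENNReal.ofReal δ :=
    (ENNReal.pow_le_pow_left_iff two_ne_zero).1 ((enorm_sq_of_ae h3).trans_le hmain)
  rw [← ofReal_norm] at h5
  exact (ENNReal.ofReal_le_ofReal_iff hδ).1 h5

end Averaging

/-! ### Expander diagrams satisfy a Poincaré inequality -/

section Poincare

/-- The measure of sets of vertices of a diagram, as a measure in the sense of Mathlib. -/
noncomputable def WeightedDiagram.vertexMeasure {W E : Type*} (D : WeightedDiagram W E) :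
    @Measure W ⊤ :=
  @Measure.sum W W ⊤ fun x => (D.μV x : ℝ≥0∞) • @Measure.dirac W ⊤ x

lemma WeightedDiagram.vertexMeasure_apply {W E : Type*} (D : WeightedDiagram W E) (S : Set W) :
    D.vertexMeasure S = D.vol S := by
  let _ : MeasurableSpace W := ⊤
  rw [WeightedDiagram.vertexMeasure, Measure.sum_apply _ MeasurableSpace.measurableSet_top,
    WeightedDiagram.vol, tsum_subtype S fun x => (D.μV x : ℝ≥0∞)]
  refine tsum_congr fun x => ?_
  rw [Measure.smul_apply, Measure.dirac_apply' _ MeasurableSpace.measurableSet_top]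
  by_cases hx : x ∈ S <;> simp [hx]

variable {V : Type*} {X : SimpleGraph V} {G : Subgroup (X ≃g X)} {Γ : Subgroup G}
  {μ : Measure (RightCosets Γ)} (hinv : ActsWithoutInversion Γ)

/-- The Poincaré inequality for the pair of functions on `Γ \ G` obtained from a function on the
quotient diagram by means of the end points of an edge of `X`. The constant `c` is a median. -/
lemma poincare_real [X.LocallyFinite] (hX : X.Connected)
    (hG : IsLocallyTransitive G) (hμ : IsInvariantVolume Γ μ)
    (hfin : ∀ x : V, Finite (MulAction.stabilizer Γ x)) (d : X.Dart)
    (hexp : (quotientDiagram Γ hinv).IsExpander) :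
    ∃ κ : ℝ, 0 < κ ∧ ∀ F : QuotientVertex Γ → ℝ, MemLp (fun q => F (orbitMap Γ d.fst q)) 2 μ →
      MemLp (fun q => F (orbitMap Γ d.snd q)) 2 μ → ∃ c : ℝ,
        κ ^ 2 * (∫ q, (F (orbitMap Γ d.fst q) - c) ^ 2 ∂μ) ≤
          4 * ∫ q, (F (orbitMap Γ d.fst q) - F (orbitMap Γ d.snd q)) ^ 2 ∂μ := by
  have := hμ.finite
  obtain ⟨C, hC, -, hup, hbd⟩ := exists_volume_comparison hinv hX hG hμ hfin d
  have hD := isFiniteVolume_quotientDiagram hinv hX hG hμ hfin d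
  set D := quotientDiagram Γ hinv with hDdef
  obtain ⟨ε, hε, hexp⟩ := hexp
  set N : ℝ≥0 := ((X.degree d.fst + X.degree d.snd : ℕ) : ℝ≥0) with hN
  have hN0 : 0 < N := by
    have := (X.degree_pos_iff_exists_adj d.fst).2 ⟨_, d.adj⟩
    rw [hN]
    exact_mod_cast Nat.add_pos_left this _
  have hκ : 0 < ε / N := div_pos hε hN0
  have iso : ∀ S : Set (QuotientVertex Γ), D.vol S ≤ D.vol Set.univ / 2 →
      ((ε / N : ℝ≥0) : ℝ≥0∞) * (μ (orbitMap Γ d.fst ⁻¹' S) + μ (orbitMap Γ d.snd ⁻¹' S)) ≤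
        μ {q | orbitMap Γ d.fst q ∈ S ∧ orbitMap Γ d.snd q ∉ S} +
          μ {q | orbitMap Γ d.snd q ∈ S ∧ orbitMap Γ d.fst q ∉ S} := by
    intro S hS
    rcases S.eq_empty_or_nonempty with rfl | hne
    · simp
    have h1 := hexp S hne hS
    rw [ENNReal.le_div_iff_mul_le (Or.inl (hD.vol_ne_zero hne)) (Or.inl (hD.vol_ne_top _))] at h1
    calc ((ε / N : ℝ≥0) : ℝ≥0∞) * (μ (orbitMap Γ d.fst ⁻¹' S) + μ (orbitMap Γ d.snd ⁻¹' S))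
        ≤ ((ε / N : ℝ≥0) : ℝ≥0∞) * (N * (C * D.vol S)) := by gcongr; exact hup S
      _ = C * (ε * D.vol S) := by
          rw [← mul_assoc, ← ENNReal.coe_mul, div_mul_cancel₀ _ hN0.ne', mul_left_comm]
      _ ≤ C * D.edgeVol (D.boundary S) := by gcongr
      _ = _ := (hbd S).symm
  refine ⟨(ε / N : ℝ≥0), hκ, fun F hF hF' => ?_⟩
  let _ : MeasurableSpace (QuotientVertex Γ) := ⊤
  have : IsFiniteMeasure D.vertexMeasure :=
    ⟨by rw [D.vertexMeasure_apply]; exact (hD.vol_ne_top _).lt_top⟩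
  obtain ⟨c, hc1, hc2⟩ := exists_median D.vertexMeasure (f := F) measurable_from_top
  simp only [D.vertexMeasure_apply] at hc1 hc2
  have volmono : ∀ {S S' : Set (QuotientVertex Γ)}, S ⊆ S' → D.vol S ≤ D.vol S' := by
    intro S S' h
    rw [← D.vertexMeasure_apply, ← D.vertexMeasure_apply]
    exact measure_mono h
  have meas : ∀ x : V, Measurable fun q => F (orbitMap Γ x q) := fun x s _ =>
    (isOpen_preimage_orbitMap_vertex Γ x (F ⁻¹' s)).measurableSet
  have h := cheeger_real (meas d.fst) (meas d.snd) hF hF' hκ c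
    (fun t ht => iso {x | t < F x} ((volmono fun x hx => ht.trans_lt hx).trans hc1))
    (fun t ht => iso {x | F x < t} ((volmono fun x hx => lt_of_lt_of_le hx ht).trans hc2))
  refine ⟨c, le_trans ?_ h⟩
  gcongr
  exact le_add_of_nonneg_right (integral_nonneg fun q => sq_nonneg _)

/-- The complex form of `poincare_real`, for classes in `L²`. -/
lemma poincare_Lp [X.LocallyFinite] (hX : X.Connected)
    (hG : IsLocallyTransitive G) (hμ : IsInvariantVolume Γ μ)
    (hfin : ∀ x : V, Finite (MulAction.stabilizer Γ x)) (d : X.Dart)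
    (hexp : (quotientDiagram Γ hinv).IsExpander) :
    ∃ κ : ℝ, 0 < κ ∧ ∀ (F : QuotientVertex Γ → ℂ) (U W : Lp ℂ 2 μ),
      U =ᵐ[μ] (fun q => F (orbitMap Γ d.fst q)) → W =ᵐ[μ] (fun q => F (orbitMap Γ d.snd q)) →
        have := hμ.finite
        ∃ c : ℂ, κ * ‖U - Lp.const 2 μ c‖ ≤ 2 * ‖U - W‖ := by
  have := hμ.finite
  obtain ⟨κ, hκ, h⟩ := poincare_real hinv hX hG hμ hfin d hexp
  refine ⟨κ, hκ, fun F U W hU hW => ?_⟩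
  have mU : MemLp (fun q => F (orbitMap Γ d.fst q)) 2 μ := (memLp_congr_ae hU).1 (Lp.memLp U)
  have mW : MemLp (fun q => F (orbitMap Γ d.snd q)) 2 μ := (memLp_congr_ae hW).1 (Lp.memLp W)
  obtain ⟨c₁, h1⟩ := h (fun x => (F x).re) mU.re mW.re
  obtain ⟨c₂, h2⟩ := h (fun x => (F x).im) mU.im mW.im
  refine ⟨⟨c₁, c₂⟩, ?_⟩
  have e1 : (U - Lp.const 2 μ ⟨c₁, c₂⟩ : Lp ℂ 2 μ) =ᵐ[μ]
      fun q => F (orbitMap Γ d.fst q) - ⟨c₁, c₂⟩ :=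
    (Lp.coeFn_sub _ _).trans (hU.sub (Lp.coeFn_const 2 μ _))
  have e2 : (U - W : Lp ℂ 2 μ) =ᵐ[μ]
      fun q => F (orbitMap Γ d.fst q) - F (orbitMap Γ d.snd q) :=
    (Lp.coeFn_sub _ _).trans (hU.sub hW)
  have normsq : ∀ z : ℂ, ‖z‖ ^ 2 = z.re ^ 2 + z.im ^ 2 := fun z => by
    rw [Complex.sq_norm, Complex.normSq_apply]
    ring
  have n1 : ‖U - Lp.const 2 μ ⟨c₁, c₂⟩‖ ^ 2 =
      (∫ q, ((F (orbitMap Γ d.fst q)).re - c₁) ^ 2 ∂μ) +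
        ∫ q, ((F (orbitMap Γ d.fst q)).im - c₂) ^ 2 ∂μ := by
    rw [norm_sq_of_ae e1]
    simp only [normsq]
    exact integral_add (mU.re.sub (memLp_const c₁)).integrable_sq
      (mU.im.sub (memLp_const c₂)).integrable_sq
  have n2 : ‖U - W‖ ^ 2 =
      (∫ q, ((F (orbitMap Γ d.fst q)).re - (F (orbitMap Γ d.snd q)).re) ^ 2 ∂μ) +
        ∫ q, ((F (orbitMap Γ d.fst q)).im - (F (orbitMap Γ d.snd q)).im) ^ 2 ∂μ := by
    rw [norm_sq_of_ae e2]
    simp only [normsq]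
    exact integral_add (mU.re.sub mW.re).integrable_sq (mU.im.sub mW.im).integrable_sq
  refine abs_le_of_sq_le_sq' ?_ (by positivity) |>.2
  rw [mul_pow, mul_pow, n1, n2]
  linarith

end Poincare

/-! ### Expander diagrams exclude almost invariant vectors -/

section Gap

variable {V : Type*} {X : SimpleGraph V} {G : Subgroup (X ≃g X)} {Γ : Subgroup G}
  {μ : Measure (RightCosets Γ)} (hinv : ActsWithoutInversion Γ)

/-- A vector that is almost invariant under the stabilizers of both end points of an edge, and under
an element mapping one end point to the other if there is one, is close to the two lifts of a
single function on the quotient diagram. -/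
lemma exists_function_on_diagram [X.LocallyFinite] (hX : X.Connected)
    (hGc : IsClosed (G : Set (X ≃g X))) (hμ : IsInvariantVolume Γ μ) (a b : V) :
    ∃ Q : Set G, IsCompact Q ∧ ∀ (ξ : Lp ℂ 2 μ) (δ : ℝ),
      (∀ g ∈ Q, ‖rightRegular hμ g ξ - ξ‖ ≤ δ) →
      ∃ (F : QuotientVertex Γ → ℂ) (U W : Lp ℂ 2 μ),
        U =ᵐ[μ] (fun q => F (orbitMap Γ a q)) ∧ W =ᵐ[μ] (fun q => F (orbitMap Γ b q)) ∧
        ‖U - ξ‖ ≤ 2 * δ ∧ ‖W - ξ‖ ≤ 2 * δ := by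
  have := countable_of_connected hX
  have := secondCountable_aut (X := X)
  have : SecondCountableTopology G :=
    TopologicalSpace.Subtype.secondCountableTopology (G : Set (X ≃g X))
  -- if `a` and `b` are in the same orbit, one average serves for both; otherwise the two averages
  -- live on disjoint sets of vertices of the diagram
  by_cases hab : ∃ g₀ : G, g₀ • a = b
  · obtain ⟨g₀, rfl⟩ := hab
    refine ⟨{g : G | g • a = a} ∪ {g₀}, (isCompact_fix hX hGc a).union isCompact_singleton,
      fun ξ δ h => ?_⟩
    have hδ : 0 ≤ δ := (norm_nonneg _).trans (h g₀ (Or.inr rfl))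
    obtain ⟨F, U, hU, hUξ⟩ := exists_average hμ (isOpen_vertex_transporter a)
      (isCompact_fix hX hGc a) ξ fun g hg => h g (Or.inl hg)
    refine ⟨F, U, rightRegular hμ g₀ U, hU, ?_, by linarith, ?_⟩
    · refine (rightRegular_coeFn hμ g₀ U).trans ?_
      refine ((hμ.measurePreserving g₀).quasiMeasurePreserving.ae_eq_comp hU).trans ?_
      refine Filter.Eventually.of_forall fun q => ?_
      simp only [Function.comp_apply, orbitMap_translate]
    · calc ‖rightRegular hμ g₀ U - ξ‖
          = ‖rightRegular hμ g₀ (U - ξ) + (rightRegular hμ g₀ ξ - ξ)‖ := by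
            rw [map_sub, sub_add_sub_cancel]
        _ ≤ ‖rightRegular hμ g₀ (U - ξ)‖ + ‖rightRegular hμ g₀ ξ - ξ‖ := norm_add_le _ _
        _ ≤ δ + δ := by
            rw [LinearIsometry.norm_map]
            exact add_le_add hUξ (h g₀ (Or.inr rfl))
        _ = 2 * δ := by ring
  · refine ⟨{g : G | g • a = a} ∪ {g : G | g • b = b},
      (isCompact_fix hX hGc a).union (isCompact_fix hX hGc b), fun ξ δ h => ?_⟩
    have hδ : 0 ≤ δ := (norm_nonneg _).trans (h 1 (Or.inl (one_smul _ _)))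
    obtain ⟨F, U, hU, hUξ⟩ := exists_average hμ (isOpen_vertex_transporter a)
      (isCompact_fix hX hGc a) ξ fun g hg => h g (Or.inl hg)
    obtain ⟨F', W, hW, hWξ⟩ := exists_average hμ (isOpen_vertex_transporter b)
      (isCompact_fix hX hGc b) ξ fun g hg => h g (Or.inr hg)
    classical
    refine ⟨fun x => if x ∈ Set.range (orbitMap Γ a) then F x else F' x, U, W, ?_, ?_,
      by linarith, by linarith⟩
    · refine hU.trans (Filter.Eventually.of_forall fun q => ?_)
      simp only
      rw [if_pos (Set.mem_range_self q)]
    · refine hW.trans (Filter.Eventually.of_forall fun q => ?_)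
      simp only
      rw [if_neg]
      rintro ⟨q', hq⟩
      obtain ⟨z, rfl⟩ := RightCosets.mk_surjective Γ q
      obtain ⟨w, rfl⟩ := RightCosets.mk_surjective Γ q'
      obtain ⟨γ, hγ⟩ := Quotient.exact hq
      refine hab ⟨z⁻¹ * ((γ : G)⁻¹ * w), ?_⟩
      have hγ : (γ : G) • z • b = w • a := hγ
      rw [mul_smul, mul_smul, ← hγ, inv_smul_smul, inv_smul_smul]

/-- An almost invariant unit vector `ξ` of `L²₀` is close to a lift of a function on the diagram
which varies little along edges. By the Poincaré inequality that function, hence `ξ`, is close to a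
constant, whereas `ξ` is orthogonal to the constants. -/
lemma not_hasAlmostInvariantVectors_of_isExpander [X.LocallyFinite] (hX : X.Connected)
    (hGc : IsClosed (G : Set (X ≃g X))) (hG : IsLocallyTransitive G) (hμ : IsInvariantVolume Γ μ)
    (hfin : ∀ x : V, Finite (MulAction.stabilizer Γ x)) (d : X.Dart)
    (hexp : (quotientDiagram Γ hinv).IsExpander) :
    ¬ HasAlmostInvariantVectors (rightRegularZero hμ) := by
  intro hai
  have := hμ.finite
  obtain ⟨κ, hκ, hpoin⟩ := poincare_Lp hinv hX hG hμ hfin d hexp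
  obtain ⟨Q, hQ, hfun⟩ := exists_function_on_diagram hX hGc hμ d.fst d.snd
  obtain ⟨⟨ξ, hξ0⟩, hξ1, δ, hδ, hξ⟩ := hai Q hQ (1 / (2 + 8 / κ)) (by positivity)
  obtain ⟨F, U, W, hU, hW, hUξ, hWξ⟩ := hfun ξ δ hξ
  obtain ⟨c, hc⟩ := hpoin F U W hU hW
  have hξ1 : ‖ξ‖ = 1 := hξ1
  have hUW : ‖U - W‖ ≤ 4 * δ := by
    calc ‖U - W‖ = ‖(U - ξ) - (W - ξ)‖ := by rw [sub_sub_sub_cancel_right]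
      _ ≤ ‖U - ξ‖ + ‖W - ξ‖ := norm_sub_le _ _
      _ ≤ _ := by linarith
  have hUc : ‖U - Lp.const 2 μ c‖ ≤ 8 / κ * δ := by
    rw [div_mul_eq_mul_div, le_div_iff₀ hκ]
    linarith
  have hξc : ‖ξ - Lp.const 2 μ c‖ ≤ (2 + 8 / κ) * δ := by
    calc ‖ξ - Lp.const 2 μ c‖ = ‖(U - Lp.const 2 μ c) - (U - ξ)‖ := by
          rw [sub_sub_sub_cancel_left]
      _ ≤ ‖U - Lp.const 2 μ c‖ + ‖U - ξ‖ := norm_sub_le _ _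
      _ ≤ _ := by linarith
  -- constants are orthogonal to `ξ`, whose integral vanishes
  have horth : inner ℂ (Lp.const 2 μ c) ξ = 0 := by
    rw [← indicatorConstLp_univ, L2.inner_indicatorConstLp_eq_inner_setIntegral,
      setIntegral_univ, show ∫ q, ξ q ∂μ = 0 from hξ0, inner_zero_right]
  have h1 : (1 : ℝ) ≤ ‖ξ - Lp.const 2 μ c‖ := by
    have h2 : inner ℂ (ξ - Lp.const 2 μ c) ξ = 1 := by
      rw [inner_sub_left, horth, sub_zero, inner_self_eq_norm_sq_to_K, hξ1]
      simp
    have h3 := norm_inner_le_norm (𝕜 := ℂ) (ξ - Lp.const 2 μ c) ξ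
    rwa [h2, hξ1, norm_one, mul_one] at h3
  have h4 : (2 + 8 / κ) * δ < 1 := by
    rw [lt_div_iff₀ (by positivity)] at hδ
    linarith
  linarith

end Gap

theorem proposition4 {V : Type*} (X : SimpleGraph V) [X.LocallyFinite] (hX : X.IsTree)
    (G : Subgroup (X ≃g X)) (hG : IsClosed (G : Set (X ≃g X)))
    (hGX :
      (∃ k : ℕ, 3 ≤ k ∧ X.IsRegularOfDegree k ∧ ActsTransitivelyOn G Set.univ) ∨
      (∃ (k₀ k₁ : ℕ) (V₀ V₁ : Set V), 3 ≤ k₀ ∧ 3 ≤ k₁ ∧ IsBiregularWith X V₀ V₁ k₀ k₁ ∧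
        ActsTransitivelyOn G V₀ ∧ ActsTransitivelyOn G V₁))
    (hloc : IsLocallyInftyTransitive G)
    (Γ : Subgroup G) (hΓ : IsLatticeSubgroup Γ) (hinv : ActsWithoutInversion Γ)
    (μ : MeasureTheory.Measure (RightCosets Γ)) (hμ : IsInvariantVolume Γ μ) :
    (quotientDiagram Γ hinv).IsFiniteVolume ∧
      (HasSpectralGap hμ ↔ (quotientDiagram Γ hinv).IsExpander) := by
  have hconn : X.Connected := hX.connected
  have hdisc : DiscreteTopology Γ := hΓ.1
  have hfin : ∀ x : V, Finite (MulAction.stabilizer Γ x) := finite_stabilizer hconn hG Γ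
  have hlt : IsLocallyTransitive G := hloc.isLocallyTransitive
  obtain ⟨d⟩ : Nonempty X.Dart := by
    obtain ⟨x⟩ := hconn.nonempty
    have hx : 0 < X.degree x := by
      rcases hGX with ⟨k, hk, hreg, -⟩ | ⟨k₀, k₁, V₀, V₁, hk₀, hk₁, hreg, -⟩
      · rw [hreg x]
        omega
      · rcases (hreg.cover ▸ Set.mem_univ x : x ∈ V₀ ∪ V₁) with h | h
        · rw [hreg.degree₀ x h]
          omega
        · rw [hreg.degree₁ x h]
          omega
    obtain ⟨y, hy⟩ := (X.degree_pos_iff_exists_adj x).1 hx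
    exact ⟨⟨(x, y), hy⟩⟩
  refine ⟨isFiniteVolume_quotientDiagram hinv hconn hlt hμ hfin d, fun h => ?_, fun h => ?_⟩
  · by_contra hexp
    exact h (hasAlmostInvariantVectors_of_not_isExpander hinv hconn hlt hμ hfin d hexp)
  · exact not_hasAlmostInvariantVectors_of_isExpander hinv hconn hG hlt hμ hfin d h
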